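/- **Setting.** Let $I_L, I_N, I_R$ be finite index sets with $n_L=|I_L|$, $n_R=|I_R|$; a tensor is $A\in\mathbb{R}^{I_L\times I_N\times I_R}$ (for a $d$-dimensional tensor and a mode $\mu$, the modes $<\mu$ and $>\mu$ are grouped into $I_L$ and $I_R$). A representation of size $r=(r_L,r_R)$ is a triple $G=(L,N,R)$ with $L\in\mathbb{R}^{I_L\times r_L}$, $N(j)\in\mathbb{R}^{r_L\times r_R}$ $(j\in I_N)$, $R\in\mathbb{R}^{r_R\times I_R}$; it represents the tensor $\tau_r(G)$ with slices $\tau_r(G)(j)=L\,N(j)\,R$. The TT-rank $r(A)=(r_L,r_R)$ consists of the ranks of the matricizations $A^{(\{1\})}\in\mathbb{R}^{I_L\times(I_N\times I_R)}$ and $A^{(\{1,2\})}\in\mathbb{R}^{(I_L\times I_N)\times I_R}$, and $\mathcal{T}(r)$ is the set of tensors of TT-rank exactly $r$. For a set $S$ of indices, $\|X\|_S^2=\sum_{p\in S}X_p^2$; $S(j)=\{(a,b):(a,j,b)\in S\}$ for $S\subset I_L\times I_N\times I_R$. A method $\mathcal{M}$ consists, for every $r$, of a class $\mathcal{D}_r$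 of admissible representations of tensors of TT-rank $r$, such that every tensor $A$ has a representation in $\mathcal{D}_{r(A)}$, and of a map $\mathcal{M}_r$ from $\mathcal{D}_r$ to representations of size $r$. It is *representation independent* if $\tau_r(G)=\tau_r(\widetilde G)$ implies $\tau_r(\mathcal{M}_r(G))=\tau_r(\mathcal{M}_r(\widetilde G))$ for all $r$ and $G,\widetilde G\in\mathcal{D}_r$. The induced map is $f_{\mathcal{M}}(A)=\tau_{r}(\mathcal{M}_{r}(G))$, where $r=r(A)$, $G\in\mathcal{D}_{r}$, $\tau_{r}(G)=A$. A representation independent method is *fix-rank stable at $A^*$* if $f_{\mathcal{M}}$ restricted to $\mathcal{T}(r(A^*))$ is continuous at $A^*$, *fix-rank stable* if $f_{\mathcal{M}}|_{\mathcal{T}(r)}$ is continuous for every $r$, and *stable (under truncation)* if $f_{\mathcal{M}}$ is continuous on $\mathbb{R}^{I_L\times I_N\times I_R}$. Fix a target tensor $B\in\mathbb{R}^{I_L\times I_N\times I_R}$ and a sampling set $S\subset I_L\times I_N\times I_R$. *Unregularized method.* $\mathcal{D}_r$ is the set of representations $(L,N,R)$ of size $r$ of tensors of TT-rank $r$, and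 $\mathcal{M}(L,N,R)=(L,N^+,R)$, where $N^+=\operatorname{argmin}_{\widetilde N}\|\tau_r(L,\widetilde N,R)-B\|_S$, with minimization of $\|\tau_r(L,\widetilde N,R)\|_F$ as secondary criterion. *iTRIP.* A tensor $A=\tau_r(L,N,R)$ of TT-rank $r$ has the internal tensor restricted isometry property (for $S$) if there are $0\le c<1$ and $\rho>0$ with $(1-c)\|\widetilde A\|_F^2\le\rho\|\widetilde A\|_S^2\le(1+c)\|\widetilde A\|_F^2$ for all $\widetilde A=\tau_r(L,\widetilde N,R)$, $\widetilde N$ arbitrary. *Regularized method.* A standard representation of a tensor $A$ of TT-rank $r$ is a quintuple $(\mathcal{L},\Sigma_L,\mathcal{N},\Sigma_R,\mathcal{R})$, with diagonal $\Sigma_L,\Sigma_R$ whose diagonals are positive and non-increasing, such that $A=\tau_r(\mathcal{L},\Sigma_L\mathcal{N}\Sigma_R,\mathcal{R})$, and such that $\mathcal{L}\cdot\Sigma_L\cdot[\mathcal{N}\Sigma_R\mathcal{R}]$ and $[\mathcal{L}\Sigma_L\mathcal{N}]\cdot\Sigma_R\cdot\mathcal{R}$ are truncated singular value decompositions of $A^{(\{1\})}$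 and $A^{(\{1,2\})}$ (brackets: right and left unfolding). For constants $\zeta_1,\zeta_2,\zeta_{1,2}$, the method $\mathcal{M}^*_\zeta$ acts on standard representations, viewed as $(\mathcal{L},\Sigma_L\mathcal{N}\Sigma_R,\mathcal{R})$, by $\mathcal{M}^*_\zeta(\mathcal{L},\Sigma_L\mathcal{N}\Sigma_R,\mathcal{R})=(\mathcal{L},N^+,\mathcal{R})$ with $$N^+(j)=\operatorname*{argmin}_{X\in\mathbb{R}^{r_L\times r_R}}\ \|\mathcal{L}X\mathcal{R}-B(j)\|_{S(j)}^2+\|Y(j)\operatorname{vec}(X)\|^2,\qquad Y(j)=\begin{pmatrix}\sqrt{n_L^{-1}\zeta_1}\;\mathcal{R}_{-,S(j)_2}^T\otimes\Sigma_L^{-1}\\ \sqrt{n_R^{-1}\zeta_2}\;\Sigma_R^{-1}\otimes\mathcal{L}_{S(j)_1,-}\\ \sqrt{\rho_j\,\zeta_{1,2}}\;\Sigma_R^{-1}\otimes\Sigma_L^{-1}\end{pmatrix},\qquad \rho_j=\frac{|S(j)|}{n_Ln_R},$$ where $\mathcal{L}_{S(j)_1,-}$ and $\mathcal{R}_{-,S(j)_2}$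 list the rows $\mathcal{L}_{a,-}$ and columns $\mathcal{R}_{-,b}$ for $(a,b)\in S(j)$, and minimization of $\|\mathcal{L}X\mathcal{R}\|_F$ is the secondary criterion (relevant only if $S(j)=\emptyset$). **Theorem (Stability of the method $\mathcal{M}^*_\zeta$).** 1. ($\omega=0$) The unregularized method is fix-rank stable at every tensor $A^*$ that has the iTRIP. 2. ($\omega>0$) For all constants $\zeta_1,\zeta_2\ge0$, $\zeta_{1,2}>0$ (independent of the rank $r$), the regularized method $\mathcal{M}^*_\zeta$ is stable under truncation, i.e. representation independent with $f_{\mathcal{M}^*_\zeta}$ continuous on the whole tensor space, across changes of TT-rank; hence it is also fix-rank stable. -/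

import Mathlib

noncomputable section

namespace TTStab

open Matrix

/-! ### Tensors of order three and representations of TT-rank `(rL, rR)` -/

/-- Real tensors of order three with finite index sets `IL`, `IN`, `IR` (left, middle, right),
with the usual topology of a finite-dimensional space. -/
abbrev Tensor (IL IN IR : Type*) := IL → IN → IR → ℝ

/-- A representation `(L, N, R)` of size `(rL, rR)`. -/
structure Rep (IL IN IR : Type*) (rL rR : ℕ) where
  /-- left interface matrix -/
  L : Matrix IL (Fin rL) ℝ
  /-- middle core, a vector of matrices -/
  N : IN → Matrix (Fin rL) (Fin rR) ℝ
  /-- right interface matrix -/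
  R : Matrix (Fin rR) IR ℝ

variable {IL IN IR : Type*} {rL rR : ℕ}

/-- The tensor represented by `(L, N, R)`; its `j`-th slice is the matrix `L * N j * R`. -/
def Rep.tensor (G : Rep IL IN IR rL rR) : Tensor IL IN IR :=
  fun a j b => (G.L * G.N j * G.R) a b

/-- The matricization `A^({1})`. -/
def matL (A : Tensor IL IN IR) : Matrix IL (IN × IR) ℝ :=
  Matrix.of fun a p => A a p.1 p.2

/-- The matricization `A^({1,2})`. -/
def matR (A : Tensor IL IN IR) : Matrix (IL × IN) IR ℝ :=
  Matrix.of fun p b => A p.1 p.2 b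

/-- The first TT-rank. -/
def rankL [Fintype IN] [Fintype IR] (A : Tensor IL IN IR) : ℕ := (matL A).rank

/-- The second TT-rank. -/
def rankR [Fintype IR] (A : Tensor IL IN IR) : ℕ := (matR A).rank

/-- The set of tensors whose TT-rank is exactly `(rL, rR)`. -/
def rankSet (IL IN IR : Type*) [Fintype IN] [Fintype IR] (rL rR : ℕ) : Set (Tensor IL IN IR) :=
  {A | rankL A = rL ∧ rankR A = rR}

/-- The squared Frobenius norm. -/
def normSq [Fintype IL] [Fintype IN] [Fintype IR] (A : Tensor IL IN IR) : ℝ :=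
  ∑ a, ∑ j, ∑ b, A a j b ^ 2

/-- The squared Euclidean norm of the restriction of a tensor to a sampling set. -/
def normSqOn (S : Finset (IL × IN × IR)) (A : Tensor IL IN IR) : ℝ :=
  ∑ p ∈ S, A p.1 p.2.1 p.2.2 ^ 2

/-! ### Methods and their stability -/

/-- A method: for every rank `(rL, rR)` it has a class `D rL rR` of admissible representations and
maps each of them to a representation of the same size. -/
structure Method (IL IN IR : Type*) where
  /-- admissible representations -/
  D : ℕ → ℕ → Type*
  /-- the underlying representation -/
  toRep : ∀ {rL rR : ℕ}, D rL rR → Rep IL IN IR rL rR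
  /-- the result of one step -/
  step : ∀ {rL rR : ℕ}, D rL rR → Rep IL IN IR rL rR

namespace Method

/-- Admissible representations of one tensor are mapped to representations of one tensor. -/
def RepresentationIndependent (M : Method IL IN IR) : Prop :=
  ∀ (rL rR : ℕ) (G G' : M.D rL rR), (M.toRep G).tensor = (M.toRep G').tensor →
    (M.step G).tensor = (M.step G').tensor

variable [Fintype IN] [Fintype IR]

/-- Every tensor has an admissible representation whose size is the TT-rank of the tensor. -/
def Covers (M : Method IL IN IR) : Prop :=
  ∀ A : Tensor IL IN IR, ∃ G : M.D (rankL A) (rankR A), (M.toRep G).tensor = A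

open Classical in
/-- The map on the whole tensor space which is induced by a method: represent `A` with its own
TT-rank, apply the step, and evaluate. (The value `0` is a placeholder, which is
never taken if the method satisfies `Covers`.) -/
def inducedMap (M : Method IL IN IR) (A : Tensor IL IN IR) : Tensor IL IN IR :=
  if h : ∃ G : M.D (rankL A) (rankR A), (M.toRep G).tensor = A then
    (M.step h.choose).tensor
  else 0

/-- Fix-rank stability at a point: the induced map, restricted to the tensors that have the same
TT-rank as `A`, is continuous at `A`. -/
def FixRankStableAt (M : Method IL IN IR) (A : Tensor IL IN IR) : Prop :=
  M.Covers ∧ M.RepresentationIndependent ∧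
    ContinuousWithinAt M.inducedMap (rankSet IL IN IR (rankL A) (rankR A)) A

/-- Fix-rank stability: the induced map is continuous on each set of tensors of fixed TT-rank. -/
def FixRankStable (M : Method IL IN IR) : Prop :=
  M.Covers ∧ M.RepresentationIndependent ∧
    ∀ rL rR : ℕ, ContinuousOn M.inducedMap (rankSet IL IN IR rL rR)

/-- Stability (under truncation): the induced map is continuous on the whole tensor space. -/
def Stable (M : Method IL IN IR) : Prop :=
  M.Covers ∧ M.RepresentationIndependent ∧ Continuous M.inducedMap

end Method

/-! ### Minimization with a secondary criterion -/

/-- `x` minimizes `C` and, among all the minimizers of `C`, it minimizes `T`. -/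
def IsSelectedMin {X : Type*} (C T : X → ℝ) (x : X) : Prop :=
  (∀ y, C x ≤ C y) ∧ ∀ y, (∀ z, C y ≤ C z) → T x ≤ T y

/-- The argument of the minimum of `C`, with `T` as secondary criterion. -/
def argMin {X : Type*} [Nonempty X] (C T : X → ℝ) : X :=
  Classical.epsilon (IsSelectedMin C T)

/-! ### The unregularized micro-step -/

section Unregularized

variable [Fintype IL] [Fintype IN] [Fintype IR]

/-- The alternating least squares micro-step for the target `B` and the sampling set `S`. It acts
on the representations of minimal size and replaces the middle core by the minimizer of
`‖L N R - B‖_S`, where `‖L N R‖_F` is the secondary criterion. -/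
def alsMethod (B : Tensor IL IN IR) (S : Finset (IL × IN × IR)) : Method IL IN IR where
  D rL rR := {G : Rep IL IN IR rL rR // G.tensor ∈ rankSet IL IN IR rL rR}
  toRep G := G.1
  step G :=
    { L := G.1.L
      N := argMin (fun N => normSqOn S ((Rep.mk G.1.L N G.1.R).tensor - B))
        (fun N => normSq (Rep.mk G.1.L N G.1.R).tensor)
      R := G.1.R }

/-- The internal tensor restricted isometry property of `A` for the sampling set `S`. -/
def HasITRIP (S : Finset (IL × IN × IR)) (A : Tensor IL IN IR) : Prop :=
  ∃ G : Rep IL IN IR (rankL A) (rankR A), G.tensor = A ∧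
    ∃ c ρ : ℝ, 0 ≤ c ∧ c < 1 ∧ 0 < ρ ∧
      ∀ N : IN → Matrix (Fin (rankL A)) (Fin (rankR A)) ℝ,
        (1 - c) * normSq (Rep.mk G.L N G.R).tensor
            ≤ ρ * normSqOn S (Rep.mk G.L N G.R).tensor ∧
          ρ * normSqOn S (Rep.mk G.L N G.R).tensor
            ≤ (1 + c) * normSq (Rep.mk G.L N G.R).tensor

end Unregularized

/-! ### The standard representation -/

/-- `M = U * diagonal σ * V` is a truncated singular value decomposition (only the positive
singular values, in decreasing order). -/
structure IsTruncatedSVD {m n : Type*} [Fintype m] [Fintype n] {r : ℕ} (M : Matrix m n ℝ)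
    (U : Matrix m (Fin r) ℝ) (σ : Fin r → ℝ) (V : Matrix (Fin r) n ℝ) : Prop where
  left_orthogonal : Uᵀ * U = 1
  right_orthogonal : V * Vᵀ = 1
  pos : ∀ i, 0 < σ i
  antitone : Antitone σ
  eq : M = U * diagonal σ * V

/-- A quintuple `(U, σL, N, σR, V)`, of the shape of a standard representation. -/
structure StdRep (IL IN IR : Type*) (rL rR : ℕ) where
  /-- left singular vectors of `A^({1})` -/
  U : Matrix IL (Fin rL) ℝ
  /-- singular values of `A^({1})` -/
  σL : Fin rL → ℝ
  /-- middle core -/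
  N : IN → Matrix (Fin rL) (Fin rR) ℝ
  /-- singular values of `A^({1,2})` -/
  σR : Fin rR → ℝ
  /-- right singular vectors of `A^({1,2})` -/
  V : Matrix (Fin rR) IR ℝ

/-- The representation `(U, ΣL N ΣR, V)`. -/
def StdRep.toRep (G : StdRep IL IN IR rL rR) : Rep IL IN IR rL rR where
  L := G.U
  N j := diagonal G.σL * G.N j * diagonal G.σR
  R := G.V

/-- The left unfolding of a vector of matrices. -/
def leftUnfold {I κ₁ κ₂ : Type*} (H : I → Matrix κ₁ κ₂ ℝ) : Matrix (κ₁ × I) κ₂ ℝ :=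
  Matrix.of fun p q => H p.2 p.1 q

/-- The right unfolding of a vector of matrices (columns indexed compatibly with `matL`). -/
def rightUnfold {I κ₁ κ₂ : Type*} (H : I → Matrix κ₁ κ₂ ℝ) : Matrix κ₁ (I × κ₂) ℝ :=
  Matrix.of fun l p => H p.1 l p.2

/-- The quintuple is a standard representation of the tensor `A` that it generates: it yields the
truncated singular value decompositions of both matricizations of `A`. -/
def StdRep.IsStandard [Fintype IL] [Fintype IN] [Fintype IR] (G : StdRep IL IN IR rL rR) : Prop :=
  IsTruncatedSVD (matL G.toRep.tensor) G.U G.σL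
      (rightUnfold fun j => G.N j * diagonal G.σR * G.V) ∧
    IsTruncatedSVD (matR G.toRep.tensor)
      (leftUnfold fun j => G.U * diagonal G.σL * G.N j) G.σR G.V

/-! ### The regularized micro-step -/

section Regularized

variable [Fintype IL] [Fintype IN] [Fintype IR] [DecidableEq IL] [DecidableEq IN] [DecidableEq IR]

/-- The slice `S(j)` of a sampling set. -/
def slice (S : Finset (IL × IN × IR)) (j : IN) : Finset (IL × IR) :=
  Finset.univ.filter fun p => (p.1, j, p.2) ∈ S

/-- The regularization matrix `Y(j)`: the three blocks are
`√(ζ₁ / nL) • (V_{-,S(j)₂}ᵀ ⊗ ΣL⁻¹)`, `√(ζ₂ / nR) • (ΣR⁻¹ ⊗ U_{S(j)₁,-})` and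
`√(ρ ζ₁₂) • (ΣR⁻¹ ⊗ ΣL⁻¹)` with `ρ = |S(j)| / (nL nR)`. -/
def regMatrix (S : Finset (IL × IN × IR)) (ζ₁ ζ₂ ζ₁₂ : ℝ) (G : StdRep IL IN IR rL rR) (j : IN) :
    Matrix ((slice S j × Fin rL) ⊕ ((Fin rR × slice S j) ⊕ (Fin rR × Fin rL)))
      (Fin rR × Fin rL) ℝ :=
  let SLinv : Matrix (Fin rL) (Fin rL) ℝ := diagonal fun i => (G.σL i)⁻¹
  let SRinv : Matrix (Fin rR) (Fin rR) ℝ := diagonal fun i => (G.σR i)⁻¹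
  let US : Matrix (slice S j) (Fin rL) ℝ := Matrix.of fun p i => G.U p.1.1 i
  let VS : Matrix (Fin rR) (slice S j) ℝ := Matrix.of fun i p => G.V i p.1.2
  let ρ : ℝ := (slice S j).card / (Fintype.card IL * Fintype.card IR)
  Matrix.fromRows (Real.sqrt ((Fintype.card IL : ℝ)⁻¹ * ζ₁) • Matrix.kronecker VSᵀ SLinv)
    (Matrix.fromRows (Real.sqrt ((Fintype.card IR : ℝ)⁻¹ * ζ₂) • Matrix.kronecker SRinv US)
      (Real.sqrt (ρ * ζ₁₂) • Matrix.kronecker SRinv SLinv))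

/-- The regularized target function for the matrix `X` in the place of the `j`-th slice of the core:
`‖U X V - B(j)‖²_{S(j)} + ‖Y(j) vec X‖²`. -/
def regObjective (B : Tensor IL IN IR) (S : Finset (IL × IN × IR)) (ζ₁ ζ₂ ζ₁₂ : ℝ)
    (G : StdRep IL IN IR rL rR) (j : IN) (X : Matrix (Fin rL) (Fin rR) ℝ) : ℝ :=
  ∑ p ∈ slice S j, ((G.U * X * G.V) p.1 p.2 - B p.1 j p.2) ^ 2 +
    ∑ i, (regMatrix S ζ₁ ζ₂ ζ₁₂ G j *ᵥ Matrix.vec X) i ^ 2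

/-- The regularized micro-step for the target `B`, the sampling set `S` and constants `ζ`. It acts
on standard representations `(U, ΣL N ΣR, V)` and replaces the middle core, slice by slice, by the
minimizer of the regularized target function, where `‖U X V‖_F` is the secondary criterion (which
matters only for the slices without any sample). -/
def regMethod (B : Tensor IL IN IR) (S : Finset (IL × IN × IR)) (ζ₁ ζ₂ ζ₁₂ : ℝ) :
    Method IL IN IR where
  D rL rR := {G : StdRep IL IN IR rL rR // G.IsStandard}
  toRep G := G.1.toRep
  step G :=
    { L := G.1.U
      N := fun j => argMin (regObjective B S ζ₁ ζ₂ ζ₁₂ G.1 j)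
        (fun X => ∑ a, ∑ b, (G.1.U * X * G.1.V) a b ^ 2)
      R := G.1.V }

end Regularized

end TTStab

end

/-!
Both micro-steps solve linear least squares problems `‖K x - b‖² → min` in the middle core, and the
minimizer is continuous in `K` wherever `K` is injective, since its coordinates then solve a linear
system with an invertible Gram matrix (`continuousWithinAt_of_leastSq`). The representations of a
tensor are however neither unique nor continuous in the tensor, so each problem has to be rewritten
with data that are continuous functions of the tensor alone.

For the unregularized method, fix `C` and `E` such that the matrices `matL A * C` and `E * matR A`
have full rank at the tensor `A` with the isometry property. The same holds for all tensors nearby,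
and for those of the same TT-rank these matrices, which are linear in the tensor, span the same
spaces as the interface matrices of every representation (`exists_core_change`). The problem is thus
one for the core between these two matrices, and the isometry property says that it is injective at
`A` (`sampleMap_coreMap_injective`).

For the regularized method, let `ML = U ΣL Uᵀ` and `MR = Vᵀ ΣR V`. These are the positive
semidefinite square roots of `matL A * (matL A)ᵀ` and `(matR A)ᵀ * matR A`, so they depend on `A`
only, and continuously, whatever happens to the rank (`continuous_of_posSemidef_mul_self`). In the
coordinates `T = U ΣL⁻¹ X ΣR⁻¹ V` the new slice is `U X V = ML T MR`, and the target function becomes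
`‖ML T MR - B(j)‖²` on the samples, plus multiples of the squared norms of the sampled columns of
`T MR`, of the sampled rows of `ML T`, and of `T` itself (`StdRep.IsStandard.regObjective_eq`). All
inverse singular values have cancelled. The coordinates `T` range over the matrices that are fixed by
the projections `U Uᵀ` and `Vᵀ V`, but minimizing over all matrices `T` gives the same result, because
these projections do not increase the target function (`StdRep.IsStandard.leastSq_projection_le`).
By the last penalty the problem is injective as soon as the slice has a sample; without samples the
secondary criterion selects the zero slice.
-/

noncomputable section

namespace TTStab

open Matrix Filter Topology

/-! ### Least squares with a secondary criterion -/

section LeastSquares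

variable {E κ κ' : Type*} [AddCommGroup E] [Module ℝ E] [Fintype κ] [Fintype κ']

/-- The least squares functional `x ↦ ‖K x - b‖²`. -/
def leastSq (K : E →ₗ[ℝ] κ → ℝ) (b : κ → ℝ) (x : E) : ℝ := ∑ i, (K x i - b i) ^ 2

theorem exists_leastSq_le (K : E →ₗ[ℝ] κ → ℝ) (b : κ → ℝ) :
    ∃ x, ∀ y, leastSq K b x ≤ leastSq K b y := by
  classical
  let e := (WithLp.linearEquiv 2 ℝ (κ → ℝ)).symm
  let K' : E →ₗ[ℝ] EuclideanSpace ℝ κ := e.toLinearMap ∘ₗ K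
  obtain ⟨x, hx⟩ := ((LinearMap.range K').orthogonalProjectionOnto (e b)).2
  refine ⟨x, fun y => ?_⟩
  have key : ∀ z, leastSq K b z = ‖e b - K' z‖ ^ 2 := by
    intro z
    rw [EuclideanSpace.norm_sq_eq]
    refine Finset.sum_congr rfl fun i _ => ?_
    rw [Real.norm_eq_abs, sq_abs, sub_sq_comm]
    rfl
  rw [key, key, hx]
  have h := Submodule.starProjection_minimal (U := LinearMap.range K') (e b)
  rw [Submodule.starProjection_apply] at h
  rw [h]
  have hb : BddBelow (Set.range fun w : LinearMap.range K' => ‖e b - w‖) :=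
    ⟨0, by rintro _ ⟨w, rfl⟩; exact norm_nonneg _⟩
  have h2 := ciInf_le hb ⟨K' y, LinearMap.mem_range_self K' y⟩
  have h3 : (0 : ℝ) ≤ ⨅ w : LinearMap.range K', ‖e b - w‖ :=
    Real.iInf_nonneg fun _ => norm_nonneg _
  exact pow_le_pow_left₀ h3 h2 2

/-- The residual of a least squares minimizer is orthogonal to the range. -/
theorem normal_equation {K : E →ₗ[ℝ] κ → ℝ} {b : κ → ℝ} {x : E}
    (hx : ∀ y, leastSq K b x ≤ leastSq K b y) (y : E) :
    ∑ i, K x i * K y i = ∑ i, b i * K y i := by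
  have expand : ∀ t : ℝ, leastSq K b (x + t • y) = leastSq K b x
      + (2 * t * (∑ i, K x i * K y i - ∑ i, b i * K y i) + t ^ 2 * ∑ i, K y i ^ 2) := by
    intro t
    simp only [leastSq, map_add, map_smul, Pi.add_apply, Pi.smul_apply, smul_eq_mul,
      ← Finset.sum_sub_distrib, Finset.mul_sum, ← Finset.sum_add_distrib]
    exact Finset.sum_congr rfl fun i _ => by ring
  set d := ∑ i, K x i * K y i - ∑ i, b i * K y i
  set q := ∑ i, K y i ^ 2
  have hq : 0 ≤ q := Finset.sum_nonneg fun i _ => sq_nonneg _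
  -- the parabola `t ↦ 2 t d + t² q` is nonnegative; test it at `t = - d / (q + 1)`
  have h := hx (x + (-d / (q + 1)) • y)
  rw [expand] at h
  have h2 : 2 * (-d / (q + 1)) * d + (-d / (q + 1)) ^ 2 * q
      = - (d ^ 2 * (q + 2)) / (q + 1) ^ 2 := by
    field_simp
    ring
  have h3 : 0 ≤ - (d ^ 2 * (q + 2)) / (q + 1) ^ 2 := by linarith
  have h4 : 0 ≤ - (d ^ 2 * (q + 2)) := by
    by_contra hneg
    exact absurd h3 (not_le.2 (div_neg_of_neg_of_pos (not_le.1 hneg) (by positivity)))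
  have h5 : d ^ 2 = 0 := by nlinarith [sq_nonneg d, mul_nonneg (sq_nonneg d) hq]
  exact sub_eq_zero.1 (pow_eq_zero_iff (two_ne_zero) |>.1 h5)

theorem leastSq_minimizers_eq {K : E →ₗ[ℝ] κ → ℝ} {b : κ → ℝ} {x y : E}
    (hx : ∀ z, leastSq K b x ≤ leastSq K b z) (hy : ∀ z, leastSq K b y ≤ leastSq K b z) :
    K x = K y := by
  have h1 := normal_equation hx (x - y)
  have h2 := normal_equation hy (x - y)
  have h3 : ∑ i, (K x i - K y i) ^ 2 = 0 := by
    have : ∑ i, (K x i - K y i) ^ 2 = ∑ i, K x i * K (x - y) i - ∑ i, K y i * K (x - y) i := by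
      rw [← Finset.sum_sub_distrib]
      refine Finset.sum_congr rfl fun i _ => ?_
      rw [map_sub, Pi.sub_apply]
      ring
    rw [this, h1, h2, sub_self]
  funext i
  have := (Finset.sum_eq_zero_iff_of_nonneg fun i _ => sq_nonneg _).1 h3 i (Finset.mem_univ i)
  exact sub_eq_zero.1 (pow_eq_zero_iff two_ne_zero |>.1 this)

/-- A least squares problem with a quadratic secondary criterion has a solution: the secondary
problem is a least squares problem on the kernel of `K`. -/
theorem exists_isSelectedMin (K : E →ₗ[ℝ] κ → ℝ) (b : κ → ℝ) (T : E →ₗ[ℝ] κ' → ℝ) :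
    ∃ x, IsSelectedMin (leastSq K b) (leastSq T 0) x := by
  obtain ⟨x₀, hx₀⟩ := exists_leastSq_le K b
  obtain ⟨k, hk⟩ := exists_leastSq_le (T ∘ₗ (LinearMap.ker K).subtype) (-T x₀)
  have shift : ∀ z : LinearMap.ker K,
      leastSq (T ∘ₗ (LinearMap.ker K).subtype) (-T x₀) z = leastSq T 0 (x₀ + z) := by
    intro z
    refine Finset.sum_congr rfl fun i _ => ?_
    simp [add_comm]
  have hK : ∀ {u v : E}, K u = K v → leastSq K b u = leastSq K b v := by
    intro u v h
    simp only [leastSq, h]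
  refine ⟨x₀ + k, fun y => ?_, fun y hy => ?_⟩
  · rw [hK (show K (x₀ + k) = K x₀ by simp)]
    exact hx₀ y
  · have hmem : y - x₀ ∈ LinearMap.ker K := by
      rw [LinearMap.mem_ker, map_sub, leastSq_minimizers_eq hy hx₀, sub_self]
    have h := hk ⟨y - x₀, hmem⟩
    rw [shift, shift] at h
    simpa using h

/-- The secondary criterion determines the image under `T` of the selected minimizer. -/
theorem isSelectedMin_image_eq {K : E →ₗ[ℝ] κ → ℝ} {b : κ → ℝ} {T : E →ₗ[ℝ] κ' → ℝ} {x y : E}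
    (hx : IsSelectedMin (leastSq K b) (leastSq T 0) x)
    (hy : IsSelectedMin (leastSq K b) (leastSq T 0) y) : T x = T y := by
  have hK : ∀ {u v : E}, K u = K v → leastSq K b u = leastSq K b v := by
    intro u v h
    simp only [leastSq, h]
  have shift : ∀ (w : E) (z : LinearMap.ker K),
      leastSq (T ∘ₗ (LinearMap.ker K).subtype) (-T w) z = leastSq T 0 (w + z) := by
    intro w z
    refine Finset.sum_congr rfl fun i _ => ?_
    simp [add_comm]
  have hmem : y - x ∈ LinearMap.ker K := by
    rw [LinearMap.mem_ker, map_sub, leastSq_minimizers_eq hy.1 hx.1, sub_self]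
  -- both `0` and `y - x` solve the secondary least squares problem on `x + ker K`
  have hmin : ∀ w : E, IsSelectedMin (leastSq K b) (leastSq T 0) w → ∀ h : w - x ∈ LinearMap.ker K,
      ∀ z, leastSq (T ∘ₗ (LinearMap.ker K).subtype) (-T x) ⟨w - x, h⟩
        ≤ leastSq (T ∘ₗ (LinearMap.ker K).subtype) (-T x) z := by
    intro w hw h z
    rw [shift, shift]
    have : x + (w - x) = w := by abel
    simp only [this]
    refine hw.2 _ fun u => ?_
    rw [hK (show K (x + z) = K x by simp)]
    exact hx.1 u
  have h := leastSq_minimizers_eq (hmin x hx (by simp)) (hmin y hy hmem)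
  simp only [LinearMap.comp_apply, Submodule.subtype_apply, sub_self, map_zero, map_sub] at h
  exact (sub_eq_zero.1 h.symm).symm

theorem argMin_spec {X : Type*} [Nonempty X] {C T : X → ℝ} (h : ∃ x, IsSelectedMin C T x) :
    IsSelectedMin C T (argMin C T) :=
  Classical.epsilon_spec h

theorem IsSelectedMin.of_comp {X Y : Type*} {C T : Y → ℝ} {φ : X → Y} {x : X}
    (hφ : Function.Surjective φ)
    (h : IsSelectedMin (fun x => C (φ x)) (fun x => T (φ x)) x) : IsSelectedMin C T (φ x) := by
  refine ⟨fun y => ?_, fun y hy => ?_⟩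
  · obtain ⟨z, rfl⟩ := hφ y
    exact h.1 z
  · obtain ⟨z, rfl⟩ := hφ y
    exact h.2 z fun w => hy _

/-- Minimizers of least squares problems depend continuously on the problem wherever the linear map
is injective: in a basis the normal equations become a linear system, whose Gram matrix is
invertible near such a point. -/
theorem continuousWithinAt_of_leastSq {X : Type*} [TopologicalSpace X] [TopologicalSpace E]
    [ContinuousAdd E] [ContinuousSMul ℝ E] [FiniteDimensional ℝ E] {s : Set X} {a : X}
    (ha : a ∈ s) {K : X → E →ₗ[ℝ] κ → ℝ} {b : κ → ℝ} {x : X → E}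
    (hK : ∀ y i, ContinuousWithinAt (fun A => K A y i) s a)
    (hinj : ∀ y, K a y = 0 → y = 0)
    (hx : ∀ᶠ A in 𝓝[s] a, ∀ y, leastSq (K A) b (x A) ≤ leastSq (K A) b y) :
    ContinuousWithinAt x s a := by
  classical
  let v := Module.finBasis ℝ E
  let G : X → Matrix (Fin (Module.finrank ℝ E)) (Fin (Module.finrank ℝ E)) ℝ :=
    fun A => Matrix.of fun k l => ∑ i, K A (v l) i * K A (v k) i
  let h : X → Fin (Module.finrank ℝ E) → ℝ := fun A k => ∑ i, b i * K A (v k) i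
  have hKv : ∀ A (c : Fin (Module.finrank ℝ E) → ℝ) i,
      K A (∑ l, c l • v l) i = ∑ l, c l * K A (v l) i := by
    intro A c i
    simp [map_sum, Finset.sum_apply]
  have hG : ∀ A c k, (G A *ᵥ c) k = ∑ i, K A (∑ l, c l • v l) i * K A (v k) i := by
    intro A c k
    simp only [hKv, G, Matrix.mulVec, dotProduct, Matrix.of_apply, Finset.sum_mul]
    rw [Finset.sum_comm]
    exact Finset.sum_congr rfl fun i _ => Finset.sum_congr rfl fun l _ => by ring
  have hGc : ContinuousWithinAt G s a := by
    refine continuousWithinAt_pi.2 fun k => continuousWithinAt_pi.2 fun l => ?_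
    exact tendsto_finsetSum _ fun i _ => (hK _ i).mul (hK _ i)
  have hhc : ContinuousWithinAt h s a := by
    refine continuousWithinAt_pi.2 fun k => ?_
    exact tendsto_finsetSum _ fun i _ => (hK _ i).const_mul _
  have hdet : (G a).det ≠ 0 := by
    intro h0
    obtain ⟨c, hc0, hc⟩ := Matrix.exists_mulVec_eq_zero_iff.2 h0
    apply hc0
    have h1 : ∑ i, K a (∑ l, c l • v l) i ^ 2 = 0 := by
      have : ∑ k, c k * (G a *ᵥ c) k = 0 := by simp [hc]
      rw [← this]
      simp only [hG, Finset.mul_sum]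
      rw [Finset.sum_comm]
      refine Finset.sum_congr rfl fun i _ => ?_
      rw [sq]
      nth_rewrite 2 [hKv]
      rw [Finset.mul_sum]
      exact Finset.sum_congr rfl fun k _ => by ring
    have h2 : ∑ l, c l • v l = 0 := by
      apply hinj
      funext i
      have := (Finset.sum_eq_zero_iff_of_nonneg fun i _ => sq_nonneg _).1 h1 i (Finset.mem_univ i)
      exact pow_eq_zero_iff two_ne_zero |>.1 this
    funext l
    exact Fintype.linearIndependent_iff.1 v.linearIndependent c h2 l
  have hdetc : ContinuousWithinAt (fun A => (G A).det) s a :=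
    (Continuous.matrix_det continuous_id).continuousAt.comp_continuousWithinAt hGc
  have hsol : ∀ᶠ A in 𝓝[s] a, x A = ∑ k, ((G A).det⁻¹ • ((G A).adjugate *ᵥ h A)) k • v k := by
    filter_upwards [hx, hdetc.eventually_ne hdet] with A hA hdA
    have hxA : ∑ l, v.repr (x A) l • v l = x A := v.sum_repr (x A)
    have h1 : G A *ᵥ v.repr (x A) = h A := by
      funext k
      rw [hG, hxA]
      exact normal_equation hA (v k)
    rw [← h1, Matrix.mulVec_mulVec, Matrix.adjugate_mul, Matrix.smul_mulVec, Matrix.one_mulVec,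
      smul_smul, inv_mul_cancel₀ hdA, one_smul, hxA]
  have hcont : ContinuousWithinAt
      (fun A => ∑ k, ((G A).det⁻¹ • ((G A).adjugate *ᵥ h A)) k • v k) s a := by
    have hadj : ContinuousWithinAt (fun A => (G A).adjugate) s a :=
      (Continuous.matrix_adjugate continuous_id).continuousAt.comp_continuousWithinAt hGc
    have hmv : ContinuousWithinAt (fun A => (G A).adjugate *ᵥ h A) s a :=
      continuousWithinAt_pi.2 fun k =>
        tendsto_finsetSum Finset.univ fun l _ => Tendsto.mul
          (continuousWithinAt_pi.1 (continuousWithinAt_pi.1 hadj k) l).tendsto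
          (continuousWithinAt_pi.1 hhc l).tendsto
    refine tendsto_finsetSum _ fun k _ => ?_
    exact ((hdetc.inv₀ hdet).mul ((continuous_apply k).continuousAt.comp_continuousWithinAt
      hmv)).smul continuousWithinAt_const
  exact hcont.congr_of_eventuallyEq hsol (hsol.self_of_nhdsWithin ha)

end LeastSquares

/-! ### Singular value decompositions and positive semidefinite square roots -/

section Spectral

variable {m n : Type*} [Fintype m] [Fintype n] [DecidableEq m]

theorem exists_orthogonal_diagonalization {D : Matrix m m ℝ} (hD : D.IsHermitian) :
    ∃ W : Matrix m m ℝ, Wᵀ * W = 1 ∧ W * Wᵀ = 1 ∧ D = W * diagonal hD.eigenvalues * Wᵀ := by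
  refine ⟨hD.eigenvectorUnitary, ?_, ?_, ?_⟩
  · have h := Unitary.coe_star_mul_self hD.eigenvectorUnitary
    rwa [star_eq_conjTranspose, conjTranspose_eq_transpose_of_trivial] at h
  · have h := Unitary.coe_mul_star_self hD.eigenvectorUnitary
    rwa [Unitary.coe_star, star_eq_conjTranspose, conjTranspose_eq_transpose_of_trivial] at h
  · have h := hD.spectral_theorem
    rw [Unitary.conjStarAlgAut_apply, star_eq_conjTranspose,
      conjTranspose_eq_transpose_of_trivial] at h
    exact h

/-- Every real matrix has a truncated singular value decomposition of the size of its rank: the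
left singular vectors are the eigenvectors of `M * Mᵀ` for the positive eigenvalues. -/
theorem exists_isTruncatedSVD (M : Matrix m n ℝ) {r : ℕ} (hr : M.rank = r) :
    ∃ (U : Matrix m (Fin r) ℝ) (σ : Fin r → ℝ) (V : Matrix (Fin r) n ℝ),
      IsTruncatedSVD M U σ V := by
  subst hr
  have hpsd : (M * Mᵀ).PosSemidef := by
    have := posSemidef_self_mul_conjTranspose M
    rwa [conjTranspose_eq_transpose_of_trivial] at this
  have hH := hpsd.isHermitian
  have hnn : ∀ k, 0 ≤ hH.eigenvalues k := hpsd.eigenvalues_nonneg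
  obtain ⟨W, hW1, hW2, hW3⟩ := exists_orthogonal_diagonalization hH
  set Q : Matrix m n ℝ := Wᵀ * M with hQ
  have hQQ : Q * Qᵀ = diagonal hH.eigenvalues := by
    have : Q * Qᵀ = Wᵀ * (M * Mᵀ) * W := by
      simp [hQ, Matrix.transpose_mul, Matrix.mul_assoc]
    calc Q * Qᵀ = Wᵀ * (M * Mᵀ) * W := this
      _ = Wᵀ * (W * diagonal hH.eigenvalues * Wᵀ) * W := congrArg (fun X => Wᵀ * X * W) hW3
      _ = (Wᵀ * W) * diagonal hH.eigenvalues * (Wᵀ * W) := by simp only [Matrix.mul_assoc]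
      _ = _ := by rw [hW1, Matrix.one_mul, Matrix.mul_one]
  have hQe : ∀ k l, ∑ p, Q k p * Q l p = if k = l then hH.eigenvalues k else 0 := by
    intro k l
    have := congrFun (congrFun hQQ k) l
    simpa [Matrix.mul_apply, diagonal_apply] using this
  have hMQ : M = W * Q := by rw [hQ, ← Matrix.mul_assoc, hW2, Matrix.one_mul]
  let e : Fin (Fintype.card m) ≃ m := Fintype.equivOfCardEq (Fintype.card_fin _)
  have he : ∀ i, hH.eigenvalues (e i) = hH.eigenvalues₀ i := by
    intro i
    simp [IsHermitian.eigenvalues, e]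
  have hanti := hH.eigenvalues₀_antitone
  have hrank : M.rank = (Finset.univ.filter fun i => hH.eigenvalues₀ i ≠ 0).card := by
    rw [← rank_self_mul_transpose, hH.rank_eq_card_non_zero_eigs, ← Fintype.card_subtype]
    refine Fintype.card_congr (e.subtypeEquiv fun i => ?_).symm
    rw [he]
  -- the eigenvalues are sorted, so the nonzero ones come first
  have hlt : ∀ i, hH.eigenvalues₀ i ≠ 0 ↔ (i : ℕ) < M.rank := by
    intro i
    constructor
    · intro hi
      have hsub : Finset.Iic i ⊆ Finset.univ.filter fun i => hH.eigenvalues₀ i ≠ 0 := by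
        intro j hj
        have h1 : hH.eigenvalues₀ i ≤ hH.eigenvalues₀ j := hanti (Finset.mem_Iic.1 hj)
        have h2 : 0 ≤ hH.eigenvalues₀ i := he i ▸ hnn (e i)
        simp only [Finset.mem_filter, Finset.mem_univ, true_and]
        exact ((lt_of_le_of_ne h2 hi.symm).trans_le h1).ne'
      have := Finset.card_le_card hsub
      rw [Fin.card_Iic, ← hrank] at this
      omega
    · intro hi h0
      have hsub : (Finset.univ.filter fun i => hH.eigenvalues₀ i ≠ 0) ⊆ Finset.Iio i := by
        intro j hj
        simp only [Finset.mem_filter, Finset.mem_univ, true_and] at hj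
        by_contra hji
        have h1 : hH.eigenvalues₀ j ≤ hH.eigenvalues₀ i :=
          hanti (not_lt.1 fun h => hji (Finset.mem_Iio.2 h))
        have h2 : 0 ≤ hH.eigenvalues₀ j := he j ▸ hnn (e j)
        exact hj (le_antisymm (h0 ▸ h1) h2)
      have := Finset.card_le_card hsub
      rw [Fin.card_Iio, ← hrank] at this
      omega
  have hle : M.rank ≤ Fintype.card m := rank_le_card_height M
  let ι : Fin M.rank → m := fun i => e (Fin.castLE hle i)
  have hι : Function.Injective ι := e.injective.comp (Fin.castLE_injective hle)
  have hpos : ∀ i, 0 < hH.eigenvalues (ι i) := fun i =>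
    lt_of_le_of_ne (hnn _) (by rw [he]; exact ((hlt _).2 (by simp)).symm)
  have hzero : ∀ k ∉ Set.range ι, ∀ p, Q k p = 0 := by
    intro k hk p
    have h0 : hH.eigenvalues k = 0 := by
      by_contra hne
      obtain ⟨i, rfl⟩ := e.surjective k
      rw [he] at hne
      exact hk ⟨⟨i, (hlt i).1 hne⟩, rfl⟩
    have h1 := hQe k k
    rw [if_pos rfl, h0] at h1
    have := (Finset.sum_eq_zero_iff_of_nonneg fun p _ => mul_self_nonneg (Q k p)).1 h1 p
      (Finset.mem_univ p)
    exact mul_self_eq_zero.1 this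
  have hsq : ∀ i, 0 < √(hH.eigenvalues (ι i)) := fun i => Real.sqrt_pos.2 (hpos i)
  refine ⟨W.submatrix id ι, fun i => √(hH.eigenvalues (ι i)),
    Matrix.of fun i p => (√(hH.eigenvalues (ι i)))⁻¹ * Q (ι i) p, ?_, ?_, hsq, ?_, ?_⟩
  · have : (W.submatrix id ι)ᵀ * W.submatrix id ι = (Wᵀ * W).submatrix ι ι := by
      ext i k
      simp [Matrix.mul_apply]
    rw [this, hW1, submatrix_one _ hι]
  · ext i k
    have : ∑ p, (√(hH.eigenvalues (ι i)))⁻¹ * Q (ι i) p * ((√(hH.eigenvalues (ι k)))⁻¹ * Q (ι k) p)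
        = (√(hH.eigenvalues (ι i)))⁻¹ * (√(hH.eigenvalues (ι k)))⁻¹ * ∑ p, Q (ι i) p * Q (ι k) p := by
      rw [Finset.mul_sum]
      exact Finset.sum_congr rfl fun p _ => by ring
    simp only [Matrix.mul_apply, Matrix.transpose_apply, Matrix.of_apply]
    rw [this, hQe, Matrix.one_apply]
    by_cases hik : i = k
    · subst hik
      rw [if_pos rfl, if_pos rfl, ← mul_inv, Real.mul_self_sqrt (hnn _),
        inv_mul_cancel₀ (hpos i).ne']
    · rw [if_neg (hι.ne hik), if_neg hik, mul_zero]
  · intro i k hik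
    apply Real.sqrt_le_sqrt
    simp only [ι, he]
    exact hanti (by simpa using hik)
  · ext a p
    conv_lhs => rw [hMQ]
    rw [Matrix.mul_apply, Matrix.mul_apply]
    refine (Fintype.sum_of_injective ι hι _ _ (fun k hk => ?_) fun i => ?_).symm
    · rw [hzero k hk, mul_zero]
    · rw [mul_diagonal, Matrix.of_apply, submatrix_apply, id, mul_assoc,
        mul_inv_cancel_left₀ (hsq i).ne']

/-- The square root of positive semidefinite matrices is Hölder continuous: for an eigenvector `v`
of `S - T` with eigenvalue `μ`, `|v ⬝ (S² - T²) v| = |μ| (v ⬝ S v + v ⬝ T v) ≥ μ²`. -/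
theorem abs_sub_le_of_posSemidef {S T : Matrix m m ℝ} (hS : S.PosSemidef) (hT : T.PosSemidef)
    (a b : m) :
    |(S - T) a b| ≤ Fintype.card m * √(∑ c, ∑ d, |(S * S - T * T) c d|) := by
  have hD : (S - T).IsHermitian := hS.isHermitian.sub hT.isHermitian
  obtain ⟨W, hW1, hW2, hW3⟩ := exists_orthogonal_diagonalization hD
  have hW1e : ∀ i, ∑ c, W c i * W c i = 1 := by
    intro i
    have := congrFun (congrFun hW1 i) i
    simpa [Matrix.mul_apply] using this
  have hWle : ∀ c i, |W c i| ≤ 1 := by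
    intro c i
    rw [← sq_le_one_iff_abs_le_one, sq, ← hW1e i]
    exact Finset.single_le_sum (f := fun c => W c i * W c i) (fun c _ => mul_self_nonneg _)
      (Finset.mem_univ c)
  have hSt : Sᵀ = S := by simpa [IsHermitian, conjTranspose_eq_transpose_of_trivial]
    using hS.isHermitian
  have hTt : Tᵀ = T := by simpa [IsHermitian, conjTranspose_eq_transpose_of_trivial]
    using hT.isHermitian
  have hμ : ∀ i, hD.eigenvalues i ^ 2 ≤ ∑ c, ∑ d, |(S * S - T * T) c d| := by
    intro i
    set μ := hD.eigenvalues i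
    let v : m → ℝ := fun c => W c i
    have hvv : v ⬝ᵥ v = 1 := hW1e i
    have heig : S *ᵥ v = T *ᵥ v + μ • v := by
      have h1 : (S - T) * W = W * diagonal hD.eigenvalues := by
        conv_lhs => rw [hW3]
        rw [Matrix.mul_assoc, hW1, Matrix.mul_one]
      have h2 : (S - T) *ᵥ v = μ • v := by
        funext c
        have := congrFun (congrFun h1 c) i
        rw [mul_diagonal] at this
        rw [Pi.smul_apply, smul_eq_mul, mul_comm]
        exact this
      rw [Matrix.sub_mulVec] at h2
      rw [← h2]
      abel
    have hsymm : ∀ X : Matrix m m ℝ, Xᵀ = X → v ⬝ᵥ (X * X) *ᵥ v = (X *ᵥ v) ⬝ᵥ (X *ᵥ v) := by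
      intro X hX
      rw [← mulVec_mulVec, dotProduct_mulVec]
      congr 1
      rw [← mulVec_transpose, hX]
    have hSv : 0 ≤ v ⬝ᵥ S *ᵥ v := by simpa using hS.dotProduct_mulVec_nonneg v
    have hTv : 0 ≤ v ⬝ᵥ T *ᵥ v := by simpa using hT.dotProduct_mulVec_nonneg v
    have hST : v ⬝ᵥ S *ᵥ v = v ⬝ᵥ T *ᵥ v + μ := by
      rw [heig, dotProduct_add, dotProduct_smul, hvv, smul_eq_mul, mul_one]
    have hE : v ⬝ᵥ (S * S - T * T) *ᵥ v = μ * (v ⬝ᵥ S *ᵥ v + v ⬝ᵥ T *ᵥ v) := by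
      rw [Matrix.sub_mulVec, dotProduct_sub, hsymm S hSt, hsymm T hTt, hST, heig]
      simp only [dotProduct_add, add_dotProduct, dotProduct_smul, smul_dotProduct, hvv,
        smul_eq_mul, dotProduct_comm (T *ᵥ v) v]
      ring
    have h1 : μ ^ 2 ≤ |v ⬝ᵥ (S * S - T * T) *ᵥ v| := by
      rw [hE, abs_mul, abs_of_nonneg (add_nonneg hSv hTv), ← sq_abs, sq]
      refine mul_le_mul_of_nonneg_left ?_ (abs_nonneg _)
      rw [abs_le]
      constructor <;> linarith
    refine h1.trans ?_
    rw [dotProduct]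
    refine (Finset.abs_sum_le_sum_abs _ _).trans (Finset.sum_le_sum fun c _ => ?_)
    rw [abs_mul]
    refine (mul_le_of_le_one_left (abs_nonneg _) (hWle c i)).trans ?_
    rw [mulVec, dotProduct]
    refine (Finset.abs_sum_le_sum_abs _ _).trans (Finset.sum_le_sum fun d _ => ?_)
    rw [abs_mul]
    exact mul_le_of_le_one_right (abs_nonneg _) (hWle d i)
  have hab : (S - T) a b = ∑ i, W a i * hD.eigenvalues i * W b i := by
    conv_lhs => rw [hW3]
    rw [Matrix.mul_apply]
    exact Finset.sum_congr rfl fun i _ => by rw [mul_diagonal, transpose_apply]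
  rw [hab]
  refine (Finset.abs_sum_le_sum_abs _ _).trans ?_
  rw [← Finset.card_univ, ← nsmul_eq_mul]
  refine Finset.sum_le_card_nsmul _ _ _ fun i _ => ?_
  rw [abs_mul, abs_mul]
  refine (mul_le_of_le_one_right (by positivity) (hWle b i)).trans ?_
  refine (mul_le_of_le_one_left (abs_nonneg _) (hWle a i)).trans ?_
  exact Real.abs_le_sqrt (hμ i)

theorem posSemidef_eq_of_mul_self_eq {S T : Matrix m m ℝ} (hS : S.PosSemidef) (hT : T.PosSemidef)
    (h : S * S = T * T) : S = T := by
  ext a b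
  have := abs_sub_le_of_posSemidef hS hT a b
  rw [h] at this
  simpa [sub_eq_zero] using this

theorem continuous_of_posSemidef_mul_self {X : Type*} [TopologicalSpace X] {M : X → Matrix m m ℝ}
    (hM : ∀ x, (M x).PosSemidef) (hc : Continuous fun x => M x * M x) : Continuous M := by
  refine continuous_pi fun a => continuous_pi fun b => continuous_iff_continuousAt.2 fun x₀ => ?_
  have hlim : Tendsto (fun x => Fintype.card m * √(∑ c, ∑ d, |(M x * M x - M x₀ * M x₀) c d|))
      (𝓝 x₀) (𝓝 0) := by
    have : Continuous fun x =>
        Fintype.card m * √(∑ c, ∑ d, |(M x * M x - M x₀ * M x₀) c d|) := by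
      have he : ∀ c d, Continuous fun x => (M x * M x - M x₀ * M x₀) c d := fun c d =>
        (hc.sub continuous_const).matrix_elem c d
      fun_prop
    simpa using this.tendsto x₀
  rw [ContinuousAt, tendsto_iff_dist_tendsto_zero]
  refine squeeze_zero (fun _ => dist_nonneg) (fun x => ?_) hlim
  rw [Real.dist_eq]
  exact abs_sub_le_of_posSemidef (hM x) (hM x₀) a b

end Spectral

/-! ### Induced maps and the existence of standard representations -/

section Covering

variable {IL IN IR : Type*} [Fintype IN] [Fintype IR] {rL rR : ℕ}

theorem Method.Covers.exists_inducedMap_eq {M : Method IL IN IR} (h : M.Covers)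
    {A : Tensor IL IN IR} (hA : A ∈ rankSet IL IN IR rL rR) :
    ∃ G : M.D rL rR, (M.toRep G).tensor = A ∧ M.inducedMap A = (M.step G).tensor := by
  obtain ⟨rfl, rfl⟩ := hA
  refine ⟨(h A).choose, (h A).choose_spec, ?_⟩
  rw [Method.inducedMap, dif_pos (h A)]

theorem Method.Stable.fixRankStable {M : Method IL IN IR} (h : M.Stable) : M.FixRankStable :=
  ⟨h.1, h.2.1, fun _ _ => h.2.2.continuousOn⟩

variable [Fintype IL]

theorem IsTruncatedSVD.left_projection_mul {m n : Type*} [Fintype m] [Fintype n] {r : ℕ}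
    {M : Matrix m n ℝ} {U : Matrix m (Fin r) ℝ} {σ : Fin r → ℝ} {V : Matrix (Fin r) n ℝ}
    (h : IsTruncatedSVD M U σ V) : U * Uᵀ * M = M := by
  conv_lhs => rw [h.eq]
  calc U * Uᵀ * (U * diagonal σ * V) = U * (Uᵀ * U) * diagonal σ * V := by
        simp only [Matrix.mul_assoc]
    _ = M := by rw [h.left_orthogonal, Matrix.mul_one, ← h.eq]

theorem IsTruncatedSVD.mul_right_projection {m n : Type*} [Fintype m] [Fintype n] {r : ℕ}
    {M : Matrix m n ℝ} {U : Matrix m (Fin r) ℝ} {σ : Fin r → ℝ} {V : Matrix (Fin r) n ℝ}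
    (h : IsTruncatedSVD M U σ V) : M * (Vᵀ * V) = M := by
  conv_lhs => rw [h.eq]
  calc U * diagonal σ * V * (Vᵀ * V) = U * diagonal σ * (V * Vᵀ) * V := by
        simp only [Matrix.mul_assoc]
    _ = M := by rw [h.right_orthogonal, Matrix.mul_one, ← h.eq]

theorem IsTruncatedSVD.diagonal_mul_inv {m n : Type*} [Fintype m] [Fintype n] {r : ℕ}
    {M : Matrix m n ℝ} {U : Matrix m (Fin r) ℝ} {σ : Fin r → ℝ} {V : Matrix (Fin r) n ℝ}
    (h : IsTruncatedSVD M U σ V) : diagonal σ * diagonal (fun i => (σ i)⁻¹) = 1 := by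
  rw [diagonal_mul_diagonal, ← diagonal_one]
  exact congrArg diagonal (funext fun i => mul_inv_cancel₀ (h.pos i).ne')

theorem IsTruncatedSVD.diagonal_inv_mul {m n : Type*} [Fintype m] [Fintype n] {r : ℕ}
    {M : Matrix m n ℝ} {U : Matrix m (Fin r) ℝ} {σ : Fin r → ℝ} {V : Matrix (Fin r) n ℝ}
    (h : IsTruncatedSVD M U σ V) : diagonal (fun i => (σ i)⁻¹) * diagonal σ = 1 := by
  rw [diagonal_mul_diagonal, ← diagonal_one]
  exact congrArg diagonal (funext fun i => inv_mul_cancel₀ (h.pos i).ne')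

theorem IsTruncatedSVD.compression_eq_one {m n : Type*} [Fintype m] [Fintype n] {r : ℕ}
    {M : Matrix m n ℝ} {U : Matrix m (Fin r) ℝ} {σ : Fin r → ℝ} {V : Matrix (Fin r) n ℝ}
    (h : IsTruncatedSVD M U σ V) : Uᵀ * M * (Vᵀ * diagonal fun i => (σ i)⁻¹) = 1 := by
  conv_lhs => rw [h.eq]
  calc Uᵀ * (U * diagonal σ * V) * (Vᵀ * diagonal fun i => (σ i)⁻¹)
      = (Uᵀ * U) * diagonal σ * (V * Vᵀ) * diagonal fun i => (σ i)⁻¹ := by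
        simp only [Matrix.mul_assoc]
    _ = 1 := by
        rw [h.left_orthogonal, h.right_orthogonal, Matrix.one_mul, Matrix.mul_one,
          h.diagonal_mul_inv]

/-- Standard representations exist: the singular value decompositions of the two matricizations
provide `U, σL` and `V, σR`, and the core is `ΣL⁻¹ Uᵀ A(j) Vᵀ ΣR⁻¹`. -/
theorem exists_isStandard [DecidableEq IL] [DecidableEq IN] {A : Tensor IL IN IR}
    (hA : A ∈ rankSet IL IN IR rL rR) :
    ∃ G : StdRep IL IN IR rL rR, G.IsStandard ∧ G.toRep.tensor = A := by
  obtain ⟨U, σL, H, hL⟩ := exists_isTruncatedSVD (matL A) hA.1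
  obtain ⟨K, σR, V, hR⟩ := exists_isTruncatedSVD (matR A) hA.2
  let s : IN → Matrix IL IR ℝ := fun j => Matrix.of fun a b => A a j b
  have hUs : ∀ j, U * (Uᵀ * s j) = s j := by
    intro j
    ext a b
    rw [← Matrix.mul_assoc]
    exact congrFun (congrFun hL.left_projection_mul a) (j, b)
  have hVs : ∀ j, s j * Vᵀ * V = s j := by
    intro j
    ext a b
    rw [Matrix.mul_assoc]
    exact congrFun (congrFun hR.mul_right_projection (a, j)) b
  let G : StdRep IL IN IR rL rR :=
    { U := U
      σL := σL
      N := fun j => diagonal (fun i => (σL i)⁻¹) * (Uᵀ * s j * Vᵀ) * diagonal (fun i => (σR i)⁻¹)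
      σR := σR
      V := V }
  have hLN : ∀ j, diagonal σL * G.N j = Uᵀ * s j * Vᵀ * diagonal (fun i => (σR i)⁻¹) := by
    intro j
    simp only [G, ← Matrix.mul_assoc]
    rw [hL.diagonal_mul_inv, Matrix.one_mul]
  have hNR : ∀ j, G.N j * diagonal σR = diagonal (fun i => (σL i)⁻¹) * (Uᵀ * s j * Vᵀ) := by
    intro j
    simp only [G, Matrix.mul_assoc]
    rw [hR.diagonal_inv_mul, Matrix.mul_one]
  have hGA : G.toRep.tensor = A := by
    funext a j b
    have : U * (diagonal σL * G.N j * diagonal σR) * V = s j := by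
      rw [hLN, Matrix.mul_assoc _ (diagonal _) (diagonal σR), hR.diagonal_inv_mul, Matrix.mul_one,
        Matrix.mul_assoc U, Matrix.mul_assoc, Matrix.mul_assoc, ← Matrix.mul_assoc (s j), hVs, hUs]
    exact congrFun (congrFun this a) b
  have hH : (rightUnfold fun j => G.N j * diagonal σR * V) = H := by
    have h1 : ∀ j, G.N j * diagonal σR * V = diagonal (fun i => (σL i)⁻¹) * (Uᵀ * s j) := by
      intro j
      rw [hNR, Matrix.mul_assoc, Matrix.mul_assoc, Matrix.mul_assoc, ← Matrix.mul_assoc (s j), hVs]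
    have h2 : diagonal (fun i => (σL i)⁻¹) * (Uᵀ * matL A) = H := by
      conv_lhs => rw [hL.eq]
      rw [Matrix.mul_assoc U, ← Matrix.mul_assoc Uᵀ, hL.left_orthogonal, Matrix.one_mul,
        ← Matrix.mul_assoc, hL.diagonal_inv_mul, Matrix.one_mul]
    simp only [h1]
    rw [← h2]
    rfl
  have hK : (leftUnfold fun j => G.U * diagonal σL * G.N j) = K := by
    have h1 : ∀ j, G.U * diagonal σL * G.N j = s j * Vᵀ * diagonal (fun i => (σR i)⁻¹) := by
      intro j
      rw [Matrix.mul_assoc, hLN, ← Matrix.mul_assoc, ← Matrix.mul_assoc,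
        show G.U * (Uᵀ * s j) = s j from hUs j]
    have h2 : matR A * Vᵀ * diagonal (fun i => (σR i)⁻¹) = K := by
      conv_lhs => rw [hR.eq]
      rw [Matrix.mul_assoc _ V, hR.right_orthogonal, Matrix.mul_one, Matrix.mul_assoc,
        hR.diagonal_mul_inv, Matrix.mul_one]
    simp only [h1]
    rw [← h2]
    rfl
  refine ⟨G, ⟨?_, ?_⟩, hGA⟩
  · rw [hGA]
    exact hH.symm ▸ hL
  · rw [hGA]
    exact hK.symm ▸ hR

/-- For a tensor of TT-rank `(rL, rR)` some `rL` combinations of the columns of `matL A`, and some `rR`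
combinations of the rows of `matR A`, are linearly independent. This is stated by one-sided
inverses. -/
theorem exists_compressions [DecidableEq IL] [DecidableEq IN] {A : Tensor IL IN IR}
    (hA : A ∈ rankSet IL IN IR rL rR) :
    ∃ (C : Matrix (IN × IR) (Fin rL) ℝ) (D : Matrix (Fin rL) IL ℝ)
      (E : Matrix (Fin rR) (IL × IN) ℝ) (F : Matrix IR (Fin rR) ℝ),
      D * (matL A * C) = 1 ∧ E * matR A * F = 1 := by
  obtain ⟨U, σL, H, hL⟩ := exists_isTruncatedSVD (matL A) hA.1
  obtain ⟨K, σR, V, hR⟩ := exists_isTruncatedSVD (matR A) hA.2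
  refine ⟨Hᵀ * diagonal fun i => (σL i)⁻¹, Uᵀ, Kᵀ, Vᵀ * diagonal fun i => (σR i)⁻¹, ?_, ?_⟩
  · rw [← Matrix.mul_assoc]
    exact hL.compression_eq_one
  · exact hR.compression_eq_one

end Covering

/-! ### The unregularized method -/

section Unregularized

variable {IL IN IR : Type*} [Fintype IL] [Fintype IN] [Fintype IR] {rL rR : ℕ}

/-- The tensor of the representation `(L, N, R)` as a linear function of the core `N`, with the
entries of the tensor listed as one vector. -/
def coreMap (L : Matrix IL (Fin rL) ℝ) (R : Matrix (Fin rR) IR ℝ) :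
    (IN → Matrix (Fin rL) (Fin rR) ℝ) →ₗ[ℝ] IL × IN × IR → ℝ where
  toFun N p := (L * N p.2.1 * R) p.1 p.2.2
  map_add' N N' := by
    funext p
    simp [Matrix.mul_add, Matrix.add_mul]
  map_smul' t N := by
    funext p
    simp

/-- The restriction to the sampling set. -/
def sampleMap (S : Finset (IL × IN × IR)) : (IL × IN × IR → ℝ) →ₗ[ℝ] S → ℝ :=
  LinearMap.funLeft ℝ ℝ (fun p : S => (p : IL × IN × IR))

omit [Fintype IL] [Fintype IN] [Fintype IR] in
theorem normSqOn_tensor_sub (S : Finset (IL × IN × IR)) (B : Tensor IL IN IR)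
    (L : Matrix IL (Fin rL) ℝ) (N : IN → Matrix (Fin rL) (Fin rR) ℝ)
    (R : Matrix (Fin rR) IR ℝ) :
    normSqOn S ((Rep.mk L N R).tensor - B)
      = leastSq (sampleMap S ∘ₗ coreMap L R) (fun p => B p.1.1 p.1.2.1 p.1.2.2) N :=
  (Finset.sum_coe_sort S fun p => ((Rep.mk L N R).tensor - B) p.1 p.2.1 p.2.2 ^ 2).symm

theorem normSq_tensor (L : Matrix IL (Fin rL) ℝ) (N : IN → Matrix (Fin rL) (Fin rR) ℝ)
    (R : Matrix (Fin rR) IR ℝ) :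
    normSq (Rep.mk L N R).tensor = leastSq (coreMap L R) 0 N := by
  simp only [normSq, leastSq, Fintype.sum_prod_type, Pi.zero_apply, sub_zero]
  rfl

theorem alsMethod_step_isSelectedMin (B : Tensor IL IN IR) (S : Finset (IL × IN × IR))
    (G : (alsMethod B S).D rL rR) :
    IsSelectedMin
      (leastSq (sampleMap S ∘ₗ coreMap G.1.L G.1.R) fun p => B p.1.1 p.1.2.1 p.1.2.2)
      (leastSq (coreMap G.1.L G.1.R) 0) ((alsMethod B S).step G).N := by
  have h := argMin_spec (exists_isSelectedMin (sampleMap S ∘ₗ coreMap G.1.L G.1.R)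
    (fun p => B p.1.1 p.1.2.1 p.1.2.2) (coreMap G.1.L G.1.R))
  simpa only [alsMethod, normSqOn_tensor_sub, normSq_tensor] using h

/-- All representations of a tensor `A` of TT-rank `(rL, rR)` are related by a change of basis to
the interface matrices `matL A * C` and `E * matR A`, as soon as the latter have full rank. -/
theorem exists_core_change (G : Rep IL IN IR rL rR)
    (C : Matrix (IN × IR) (Fin rL) ℝ) (D : Matrix (Fin rL) IL ℝ)
    (E : Matrix (Fin rR) (IL × IN) ℝ) (F : Matrix IR (Fin rR) ℝ)
    (hC : (D * (matL G.tensor * C)).det ≠ 0) (hE : (E * matR G.tensor * F).det ≠ 0) :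
    ∃ φ : (IN → Matrix (Fin rL) (Fin rR) ℝ) → IN → Matrix (Fin rL) (Fin rR) ℝ,
      Function.Surjective φ ∧
      ∀ N, coreMap G.L G.R N = coreMap (matL G.tensor * C) (E * matR G.tensor) (φ N) := by
  have hL : matL G.tensor = G.L * rightUnfold fun j => G.N j * G.R := by
    ext a p
    simp only [matL, Rep.tensor, Matrix.of_apply, Matrix.mul_assoc]
    rfl
  have hR : matR G.tensor = (leftUnfold fun j => G.L * G.N j) * G.R := rfl
  set P := (rightUnfold fun j => G.N j * G.R) * C
  set Q := E * leftUnfold fun j => G.L * G.N j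
  have hLP : matL G.tensor * C = G.L * P := by rw [hL, Matrix.mul_assoc]
  have hQR : E * matR G.tensor = Q * G.R := by rw [hR, Matrix.mul_assoc]
  have hP : IsUnit P.det := by
    rw [hLP, ← Matrix.mul_assoc, det_mul] at hC
    exact (right_ne_zero_of_mul hC).isUnit
  have hQ : IsUnit Q.det := by
    rw [hQR, Matrix.mul_assoc, det_mul] at hE
    exact (left_ne_zero_of_mul hE).isUnit
  refine ⟨fun N j => P⁻¹ * N j * Q⁻¹, fun N => ⟨fun j => P * N j * Q, ?_⟩, fun N => ?_⟩
  · funext j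
    calc P⁻¹ * (P * N j * Q) * Q⁻¹ = (P⁻¹ * P) * N j * (Q * Q⁻¹) := by simp only [Matrix.mul_assoc]
      _ = N j := by
        rw [nonsing_inv_mul P hP, mul_nonsing_inv Q hQ, Matrix.one_mul, Matrix.mul_one]
  · funext p
    have : G.L * P * (P⁻¹ * N p.2.1 * Q⁻¹) * (Q * G.R) = G.L * N p.2.1 * G.R := by
      calc G.L * P * (P⁻¹ * N p.2.1 * Q⁻¹) * (Q * G.R)
          = G.L * (P * P⁻¹) * N p.2.1 * (Q⁻¹ * Q) * G.R := by simp only [Matrix.mul_assoc]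
        _ = G.L * N p.2.1 * G.R := by
          rw [nonsing_inv_mul Q hQ, mul_nonsing_inv P hP, Matrix.mul_one, Matrix.mul_one]
    rw [hLP, hQR]
    exact (congrFun (congrFun this p.1) p.2.2).symm

/-- The micro-step in the coordinates given by the interface matrices `matL A * C` and
`E * matR A`. -/
theorem alsMethod_exists_core (B : Tensor IL IN IR) (S : Finset (IL × IN × IR))
    (C : Matrix (IN × IR) (Fin rL) ℝ) (D : Matrix (Fin rL) IL ℝ)
    (E : Matrix (Fin rR) (IL × IN) ℝ) (F : Matrix IR (Fin rR) ℝ) {A : Tensor IL IN IR}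
    (hC : (D * (matL A * C)).det ≠ 0) (hE : (E * matR A * F).det ≠ 0)
    (G : (alsMethod B S).D rL rR) (hG : ((alsMethod B S).toRep G).tensor = A) :
    ∃ N, IsSelectedMin
        (leastSq (sampleMap S ∘ₗ coreMap (matL A * C) (E * matR A))
          fun p => B p.1.1 p.1.2.1 p.1.2.2)
        (leastSq (coreMap (matL A * C) (E * matR A)) 0) N ∧
      ((alsMethod B S).step G).tensor
        = fun a j b => coreMap (matL A * C) (E * matR A) N (a, j, b) := by
  subst hG
  obtain ⟨φ, hφ, hφe⟩ := exists_core_change G.1 C D E F hC hE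
  refine ⟨φ ((alsMethod B S).step G).N, IsSelectedMin.of_comp hφ ?_, ?_⟩
  · have h := alsMethod_step_isSelectedMin B S G
    have e1 : ∀ N, leastSq (sampleMap S ∘ₗ coreMap G.1.L G.1.R)
          (fun p => B p.1.1 p.1.2.1 p.1.2.2) N
        = leastSq (sampleMap S ∘ₗ coreMap (matL G.1.tensor * C) (E * matR G.1.tensor))
          (fun p => B p.1.1 p.1.2.1 p.1.2.2) (φ N) := by
      intro N
      simp only [leastSq, LinearMap.comp_apply, hφe N]
    have e2 : ∀ N, leastSq (coreMap G.1.L G.1.R) 0 N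
        = leastSq (coreMap (matL G.1.tensor * C) (E * matR G.1.tensor)) 0 (φ N) := by
      intro N
      simp only [leastSq, hφe N]
    rw [funext e1, funext e2] at h
    exact h
  · funext a j b
    exact congrFun (hφe ((alsMethod B S).step G).N) (a, j, b)

variable [DecidableEq IL] [DecidableEq IN]

theorem alsMethod_covers (B : Tensor IL IN IR) (S : Finset (IL × IN × IR)) :
    (alsMethod B S).Covers := by
  intro A
  obtain ⟨G, -, hG⟩ := exists_isStandard (A := A) ⟨rfl, rfl⟩
  exact ⟨⟨G.toRep, by rw [hG]; exact ⟨rfl, rfl⟩⟩, hG⟩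

theorem alsMethod_representationIndependent (B : Tensor IL IN IR) (S : Finset (IL × IN × IR)) :
    (alsMethod B S).RepresentationIndependent := by
  intro rL rR G G' h
  obtain ⟨C, D, E, F, h1, h2⟩ := exists_compressions G.2
  have hC : (D * (matL G.1.tensor * C)).det ≠ 0 := by simp [h1]
  have hE : (E * matR G.1.tensor * F).det ≠ 0 := by simp [h2]
  obtain ⟨N, hN, hNe⟩ := alsMethod_exists_core B S C D E F hC hE G rfl
  obtain ⟨N', hN', hNe'⟩ := alsMethod_exists_core B S C D E F hC hE G' h.symm
  rw [hNe, hNe', isSelectedMin_image_eq hN hN']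

omit [Fintype IL] [Fintype IN] [Fintype IR] [DecidableEq IL] [DecidableEq IN] in
theorem continuous_matL : Continuous (matL : Tensor IL IN IR → Matrix IL (IN × IR) ℝ) := by
  refine continuous_pi fun a => continuous_pi fun p => ?_
  change Continuous fun A : Tensor IL IN IR => A a p.1 p.2
  fun_prop

omit [Fintype IL] [Fintype IN] [Fintype IR] [DecidableEq IL] [DecidableEq IN] in
theorem continuous_matR : Continuous (matR : Tensor IL IN IR → Matrix (IL × IN) IR ℝ) := by
  refine continuous_pi fun p => continuous_pi fun b => ?_
  change Continuous fun A : Tensor IL IN IR => A p.1 p.2 b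
  fun_prop

/-- The interface matrices `matL A' * C` and `E * matR A'` depend continuously on `A'` and represent
all tensors `A'` near `A` of the same TT-rank; so does the core, wherever the samples determine it. -/
theorem alsMethod_continuousWithinAt (B : Tensor IL IN IR) (S : Finset (IL × IN × IR))
    {A : Tensor IL IN IR} (hA : A ∈ rankSet IL IN IR rL rR)
    (C : Matrix (IN × IR) (Fin rL) ℝ) (D : Matrix (Fin rL) IL ℝ)
    (E : Matrix (Fin rR) (IL × IN) ℝ) (F : Matrix IR (Fin rR) ℝ)
    (hC : (D * (matL A * C)).det ≠ 0) (hE : (E * matR A * F).det ≠ 0)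
    (hinj : ∀ N, sampleMap S (coreMap (matL A * C) (E * matR A) N) = 0 → N = 0) :
    ContinuousWithinAt (alsMethod B S).inducedMap (rankSet IL IN IR rL rR) A := by
  have hLc : Continuous fun A' : Tensor IL IN IR => matL A' * C :=
    continuous_matL.matrix_mul continuous_const
  have hRc : Continuous fun A' : Tensor IL IN IR => E * matR A' :=
    continuous_const.matrix_mul continuous_matR
  have hCev : ∀ᶠ A' in 𝓝[rankSet IL IN IR rL rR] A, (D * (matL A' * C)).det ≠ 0 :=
    nhdsWithin_le_nhds
      (((continuous_const.matrix_mul hLc).matrix_det).continuousAt.eventually_ne hC)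
  have hEev : ∀ᶠ A' in 𝓝[rankSet IL IN IR rL rR] A, (E * matR A' * F).det ≠ 0 :=
    nhdsWithin_le_nhds
      (((hRc.matrix_mul continuous_const).matrix_det).continuousAt.eventually_ne hE)
  have hex : ∀ A' : Tensor IL IN IR, ∃ N : IN → Matrix (Fin rL) (Fin rR) ℝ,
      A' ∈ rankSet IL IN IR rL rR → (D * (matL A' * C)).det ≠ 0 →
      (E * matR A' * F).det ≠ 0 →
      (∀ N', leastSq (sampleMap S ∘ₗ coreMap (matL A' * C) (E * matR A'))
          (fun p => B p.1.1 p.1.2.1 p.1.2.2) N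
        ≤ leastSq (sampleMap S ∘ₗ coreMap (matL A' * C) (E * matR A'))
          (fun p => B p.1.1 p.1.2.1 p.1.2.2) N') ∧
      (alsMethod B S).inducedMap A'
        = fun a j b => coreMap (matL A' * C) (E * matR A') N (a, j, b) := by
    intro A'
    by_cases h : A' ∈ rankSet IL IN IR rL rR ∧ (D * (matL A' * C)).det ≠ 0 ∧
        (E * matR A' * F).det ≠ 0
    · obtain ⟨G', hG', hind⟩ := (alsMethod_covers B S).exists_inducedMap_eq h.1
      obtain ⟨N, hN, hNe⟩ := alsMethod_exists_core B S C D E F h.2.1 h.2.2 G' hG'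
      exact ⟨N, fun _ _ _ => ⟨hN.1, hind.trans hNe⟩⟩
    · exact ⟨0, fun h1 h2 h3 => absurd ⟨h1, h2, h3⟩ h⟩
  choose N hN using hex
  have hentry : ∀ p, Continuous
      fun q : Tensor IL IN IR × (IN → Matrix (Fin rL) (Fin rR) ℝ) =>
        coreMap (matL q.1 * C) (E * matR q.1) q.2 p := by
    intro p
    exact (((hLc.comp continuous_fst).matrix_mul
      ((continuous_apply p.2.1).comp continuous_snd)).matrix_mul
        (hRc.comp continuous_fst)).matrix_elem p.1 p.2.2
  have hNc : ContinuousWithinAt N (rankSet IL IN IR rL rR) A := by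
    refine continuousWithinAt_of_leastSq hA
      (K := fun A' => sampleMap S ∘ₗ coreMap (matL A' * C) (E * matR A'))
      (b := fun p => B p.1.1 p.1.2.1 p.1.2.2) (fun y p => ?_) hinj ?_
    · exact ((hentry p.1).comp (Continuous.prodMk_left y)).continuousWithinAt
    · filter_upwards [hCev, hEev, self_mem_nhdsWithin] with A' h3 h4 h5
      exact (hN A' h5 h3 h4).1
  have hpair : ContinuousWithinAt (fun A' => (A', N A')) (rankSet IL IN IR rL rR) A :=
    continuousWithinAt_id.prodMk hNc
  have hlim' : ∀ p, ContinuousWithinAt (fun A' => coreMap (matL A' * C) (E * matR A') (N A') p)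
      (rankSet IL IN IR rL rR) A := fun p =>
    ContinuousAt.comp_continuousWithinAt (f := fun A' => (A', N A')) (hentry p).continuousAt hpair
  have hlim : ContinuousWithinAt (fun A' a j b =>
      coreMap (matL A' * C) (E * matR A') (N A') (a, j, b)) (rankSet IL IN IR rL rR) A :=
    continuousWithinAt_pi.2 fun a => continuousWithinAt_pi.2 fun j =>
      continuousWithinAt_pi.2 fun b => hlim' (a, j, b)
  refine hlim.congr_of_eventuallyEq ?_ (hN A hA hC hE).2
  filter_upwards [hCev, hEev, self_mem_nhdsWithin] with A' h3 h4 h5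
  exact (hN A' h5 h3 h4).2

omit [DecidableEq IL] [DecidableEq IN] in
/-- The lower bound of the isometry property makes the sampled least squares problem injective, in
any choice of full-rank interface matrices. -/
theorem sampleMap_coreMap_injective (S : Finset (IL × IN × IR)) (G : Rep IL IN IR rL rR)
    (C : Matrix (IN × IR) (Fin rL) ℝ) (D : Matrix (Fin rL) IL ℝ)
    (E : Matrix (Fin rR) (IL × IN) ℝ) (F : Matrix IR (Fin rR) ℝ)
    (h1 : D * (matL G.tensor * C) = 1) (h2 : E * matR G.tensor * F = 1) {c ρ : ℝ} (hc : c < 1)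
    (hrip : ∀ N, (1 - c) * normSq (Rep.mk G.L N G.R).tensor
      ≤ ρ * normSqOn S (Rep.mk G.L N G.R).tensor)
    {N : IN → Matrix (Fin rL) (Fin rR) ℝ}
    (hN : sampleMap S (coreMap (matL G.tensor * C) (E * matR G.tensor) N) = 0) : N = 0 := by
  obtain ⟨φ, hφ, hφe⟩ := exists_core_change G C D E F (by simp [h1]) (by simp [h2])
  obtain ⟨M, rfl⟩ := hφ N
  have hM : normSqOn S (Rep.mk G.L M G.R).tensor = 0 := by
    have h0 := normSqOn_tensor_sub S 0 G.L M G.R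
    rw [sub_zero] at h0
    rw [h0]
    refine Finset.sum_eq_zero fun p _ => ?_
    rw [LinearMap.comp_apply, hφe, hN]
    simp
  have hM0 : normSq (Rep.mk G.L M G.R).tensor ≤ 0 := by
    have := hrip M
    rw [hM, mul_zero] at this
    exact nonpos_of_mul_nonpos_right this (by linarith)
  rw [normSq_tensor] at hM0
  have hz : coreMap G.L G.R M = 0 := by
    funext p
    have h3 := (Finset.sum_eq_zero_iff_of_nonneg fun p _ => sq_nonneg _).1
      (le_antisymm hM0 (Finset.sum_nonneg fun p _ => sq_nonneg _)) p (Finset.mem_univ p)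
    simpa using h3
  rw [hφe] at hz
  funext j
  have hz' : matL G.tensor * C * φ M j * (E * matR G.tensor) = 0 := by
    ext a b
    exact congrFun hz (a, j, b)
  calc φ M j = D * (matL G.tensor * C) * φ M j * (E * matR G.tensor * F) := by
        rw [h1, h2, Matrix.one_mul, Matrix.mul_one]
    _ = D * (matL G.tensor * C * φ M j * (E * matR G.tensor)) * F := by
        simp only [Matrix.mul_assoc]
    _ = 0 := by rw [hz', Matrix.mul_zero, Matrix.zero_mul]

theorem alsMethod_fixRankStableAt (B : Tensor IL IN IR) (S : Finset (IL × IN × IR))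
    {A : Tensor IL IN IR} (hA : HasITRIP S A) : (alsMethod B S).FixRankStableAt A := by
  refine ⟨alsMethod_covers B S, alsMethod_representationIndependent B S, ?_⟩
  obtain ⟨G, hG, c, ρ, -, hc1, -, hrip⟩ := hA
  have hAmem : A ∈ rankSet IL IN IR (rankL A) (rankR A) := ⟨rfl, rfl⟩
  obtain ⟨C, D, E, F, h1, h2⟩ := exists_compressions hAmem
  refine alsMethod_continuousWithinAt B S hAmem C D E F (by simp [h1]) (by simp [h2])
    fun N hN => ?_
  exact sampleMap_coreMap_injective S G C D E F (by rw [hG, h1]) (by rw [hG, h2]) hc1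
    (fun N => (hrip N).1) (by rw [hG]; exact hN)

end Unregularized

/-! ### The regularized method -/

section SumSq

variable {m n : Type*} {r : ℕ}

theorem sum_sq_orthonormal_mul [Fintype m] {U : Matrix m (Fin r) ℝ} (hU : Uᵀ * U = 1)
    (Y : Matrix (Fin r) n ℝ) (b : n) : ∑ a, (U * Y) a b ^ 2 = ∑ i, Y i b ^ 2 := by
  have h : (U * Y)ᵀ * (U * Y) = Yᵀ * Y := by
    rw [transpose_mul, Matrix.mul_assoc, ← Matrix.mul_assoc Uᵀ, hU, Matrix.one_mul]
  have := congrFun (congrFun h b) b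
  simpa only [Matrix.mul_apply (M := (U * Y)ᵀ), Matrix.mul_apply (M := Yᵀ), transpose_apply,
    ← sq] using this

theorem sum_sq_mul_orthonormal [Fintype n] {V : Matrix (Fin r) n ℝ} (hV : V * Vᵀ = 1)
    (Y : Matrix m (Fin r) ℝ) (a : m) : ∑ b, (Y * V) a b ^ 2 = ∑ i, Y a i ^ 2 := by
  have h := sum_sq_orthonormal_mul (U := Vᵀ) (by rwa [transpose_transpose]) Yᵀ a
  rwa [← transpose_mul] at h

/-- Orthogonal projections do not increase the norm. -/
theorem sum_sq_projection_mul_le [Fintype m] {U : Matrix m (Fin r) ℝ} (hU : Uᵀ * U = 1)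
    (Y : Matrix m n ℝ) (b : n) : ∑ a, (U * Uᵀ * Y) a b ^ 2 ≤ ∑ a, Y a b ^ 2 := by
  have horth : ∑ a, (U * Uᵀ * Y) a b * Y a b = ∑ a, (U * Uᵀ * Y) a b ^ 2 := by
    have h : (U * Uᵀ * Y)ᵀ * Y = (U * Uᵀ * Y)ᵀ * (U * Uᵀ * Y) := by
      have h1 : (U * Uᵀ * Y)ᵀ = Yᵀ * (U * Uᵀ) := by
        rw [transpose_mul, transpose_mul, transpose_transpose]
      have h2 : U * Uᵀ * (U * Uᵀ) = U * Uᵀ := by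
        rw [Matrix.mul_assoc, ← Matrix.mul_assoc Uᵀ, hU, Matrix.one_mul]
      rw [h1, Matrix.mul_assoc Yᵀ, Matrix.mul_assoc Yᵀ, ← Matrix.mul_assoc (U * Uᵀ), h2]
    have := congrFun (congrFun h b) b
    simpa only [Matrix.mul_apply (M := (U * Uᵀ * Y)ᵀ), transpose_apply, ← sq] using this
  have h2 : 0 ≤ ∑ a, (Y a b - (U * Uᵀ * Y) a b) ^ 2 := Finset.sum_nonneg fun _ _ => sq_nonneg _
  have h3 : ∑ a, (Y a b - (U * Uᵀ * Y) a b) ^ 2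
      = ∑ a, Y a b ^ 2 - 2 * ∑ a, (U * Uᵀ * Y) a b * Y a b + ∑ a, (U * Uᵀ * Y) a b ^ 2 := by
    rw [Finset.mul_sum, ← Finset.sum_sub_distrib, ← Finset.sum_add_distrib]
    exact Finset.sum_congr rfl fun a _ => by ring
  rw [h3, horth] at h2
  linarith

theorem sum_sq_mul_projection_le [Fintype n] {V : Matrix (Fin r) n ℝ} (hV : V * Vᵀ = 1)
    (Y : Matrix m n ℝ) (a : m) : ∑ b, (Y * (Vᵀ * V)) a b ^ 2 ≤ ∑ b, Y a b ^ 2 := by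
  have h := sum_sq_projection_mul_le (U := Vᵀ) (by rwa [transpose_transpose]) Yᵀ a
  rw [transpose_transpose] at h
  have e : Vᵀ * V * Yᵀ = (Y * (Vᵀ * V))ᵀ := by
    simp only [transpose_mul, transpose_transpose]
  rwa [e] at h

end SumSq

section RegMap

variable {IL IR : Type*} [Fintype IL] [Fintype IR]

/-- The linear map of the regularized least squares problem in the coordinates `T` of the whole
matrix space, where `ML * T * MR` is the candidate for the slice. The four blocks are the samples
of the slice and the three penalties. -/
def regMap (s : Finset (IL × IR)) (c₁ c₂ c₃ : ℝ) (ML : Matrix IL IL ℝ) (MR : Matrix IR IR ℝ) :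
    Matrix IL IR ℝ →ₗ[ℝ] ((s ⊕ (s × IL)) ⊕ ((IR × s) ⊕ (IL × IR))) → ℝ where
  toFun T := Sum.elim
    (Sum.elim (fun p => (ML * T * MR) p.1.1 p.1.2) (fun q => c₁ * (T * MR) q.2 q.1.1.2))
    (Sum.elim (fun q => c₂ * (ML * T) q.2.1.1 q.1) (fun q => c₃ * T q.1 q.2))
  map_add' T T' := by
    funext q
    rcases q with (q | q) | (q | q) <;> simp [Matrix.mul_add, Matrix.add_mul, mul_add]
  map_smul' t T := by
    funext q
    rcases q with (q | q) | (q | q) <;> simp [mul_left_comm]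

/-- The right-hand side that belongs to `regMap`: the samples of the target, and zero in the
penalties. -/
def regTarget (s : Finset (IL × IR)) (Bj : Matrix IL IR ℝ) :
    ((s ⊕ (s × IL)) ⊕ ((IR × s) ⊕ (IL × IR))) → ℝ :=
  Sum.elim (Sum.elim (fun p => Bj p.1.1 p.1.2) 0) 0

theorem leastSq_regMap (s : Finset (IL × IR)) (c₁ c₂ c₃ : ℝ) (ML : Matrix IL IL ℝ)
    (MR : Matrix IR IR ℝ) (Bj T : Matrix IL IR ℝ) :
    leastSq (regMap s c₁ c₂ c₃ ML MR) (regTarget s Bj) T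
      = (∑ p ∈ s, ((ML * T * MR) p.1 p.2 - Bj p.1 p.2) ^ 2
        + c₁ ^ 2 * ∑ p : s, ∑ a, (T * MR) a p.1.2 ^ 2)
        + (c₂ ^ 2 * ∑ p : s, ∑ b, (ML * T) p.1.1 b ^ 2 + c₃ ^ 2 * ∑ a, ∑ b, T a b ^ 2) := by
  rw [← Finset.sum_coe_sort s fun p => ((ML * T * MR) p.1 p.2 - Bj p.1 p.2) ^ 2,
    Finset.sum_comm (f := fun (p : s) b => (ML * T) p.1.1 b ^ 2)]
  simp only [leastSq, regMap, regTarget, LinearMap.coe_mk, AddHom.coe_mk, Fintype.sum_sum_type,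
    Sum.elim_inl, Sum.elim_inr, Pi.zero_apply, sub_zero, Fintype.sum_prod_type, mul_pow,
    Finset.mul_sum]

theorem regMap_injective (s : Finset (IL × IR)) (c₁ c₂ : ℝ) {c₃ : ℝ} (hc : c₃ ≠ 0)
    (ML : Matrix IL IL ℝ) (MR : Matrix IR IR ℝ) {T : Matrix IL IR ℝ}
    (h : regMap s c₁ c₂ c₃ ML MR T = 0) : T = 0 := by
  ext a b
  have : c₃ * T a b = 0 := congrFun h (Sum.inr (Sum.inr (a, b)))
  exact (mul_eq_zero.1 this).resolve_left hc

end RegMap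

section Regularized

variable {IL IN IR : Type*} [Fintype IL] [Fintype IN] [Fintype IR] {rL rR : ℕ}

/-- The positive semidefinite matrix `U ΣL Uᵀ`, the square root of `A^({1}) (A^({1}))ᵀ`. -/
def StdRep.sqrtL (G : StdRep IL IN IR rL rR) : Matrix IL IL ℝ := G.U * diagonal G.σL * G.Uᵀ

/-- The positive semidefinite matrix `Vᵀ ΣR V`, the square root of `(A^({1,2}))ᵀ A^({1,2})`. -/
def StdRep.sqrtR (G : StdRep IL IN IR rL rR) : Matrix IR IR ℝ := G.Vᵀ * diagonal G.σR * G.V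

/-- The coordinates `U ΣL⁻¹ X ΣR⁻¹ V` of the matrix `U X V` with respect to multiplication by
`sqrtL` and `sqrtR`. -/
def StdRep.coord (G : StdRep IL IN IR rL rR) :
    Matrix (Fin rL) (Fin rR) ℝ →ₗ[ℝ] Matrix IL IR ℝ where
  toFun X := G.U * (diagonal (fun i => (G.σL i)⁻¹) * X * diagonal fun i => (G.σR i)⁻¹) * G.V
  map_add' X Y := by simp [Matrix.mul_add, Matrix.add_mul]
  map_smul' t X := by simp

variable {G : StdRep IL IN IR rL rR}

theorem StdRep.IsStandard.sqrtL_posSemidef (hG : G.IsStandard) : G.sqrtL.PosSemidef := by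
  have h : (diagonal G.σL).PosSemidef := posSemidef_diagonal_iff.2 fun i => (hG.1.pos i).le
  have := h.mul_mul_conjTranspose_same G.U
  rwa [conjTranspose_eq_transpose_of_trivial] at this

theorem StdRep.IsStandard.sqrtR_posSemidef (hG : G.IsStandard) : G.sqrtR.PosSemidef := by
  have h : (diagonal G.σR).PosSemidef := posSemidef_diagonal_iff.2 fun i => (hG.2.pos i).le
  have := h.conjTranspose_mul_mul_same G.V
  rwa [conjTranspose_eq_transpose_of_trivial] at this

theorem StdRep.IsStandard.sqrtL_mul_self (hG : G.IsStandard) :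
    G.sqrtL * G.sqrtL = matL G.toRep.tensor * (matL G.toRep.tensor)ᵀ := by
  rw [hG.1.eq, StdRep.sqrtL]
  set H := rightUnfold fun j => G.N j * diagonal G.σR * G.V
  calc G.U * diagonal G.σL * G.Uᵀ * (G.U * diagonal G.σL * G.Uᵀ)
      = G.U * diagonal G.σL * (G.Uᵀ * G.U) * diagonal G.σL * G.Uᵀ := by
        simp only [Matrix.mul_assoc]
    _ = G.U * diagonal G.σL * (H * Hᵀ) * diagonal G.σL * G.Uᵀ := by
        rw [hG.1.left_orthogonal, hG.1.right_orthogonal]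
    _ = G.U * diagonal G.σL * H * (G.U * diagonal G.σL * H)ᵀ := by
        simp only [transpose_mul, diagonal_transpose, Matrix.mul_assoc]

theorem StdRep.IsStandard.sqrtR_mul_self (hG : G.IsStandard) :
    G.sqrtR * G.sqrtR = (matR G.toRep.tensor)ᵀ * matR G.toRep.tensor := by
  rw [hG.2.eq, StdRep.sqrtR]
  set H := leftUnfold fun j => G.U * diagonal G.σL * G.N j
  calc G.Vᵀ * diagonal G.σR * G.V * (G.Vᵀ * diagonal G.σR * G.V)
      = G.Vᵀ * diagonal G.σR * (G.V * G.Vᵀ) * diagonal G.σR * G.V := by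
        simp only [Matrix.mul_assoc]
    _ = G.Vᵀ * diagonal G.σR * (Hᵀ * H) * diagonal G.σR * G.V := by
        rw [hG.2.left_orthogonal, hG.2.right_orthogonal]
    _ = (H * diagonal G.σR * G.V)ᵀ * (H * diagonal G.σR * G.V) := by
        simp only [transpose_mul, diagonal_transpose, Matrix.mul_assoc]

theorem StdRep.IsStandard.sqrtL_mul_coord (hG : G.IsStandard) (X : Matrix (Fin rL) (Fin rR) ℝ) :
    G.sqrtL * G.coord X = G.U * (X * diagonal fun i => (G.σR i)⁻¹) * G.V := by
  change G.U * diagonal G.σL * G.Uᵀ *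
    (G.U * (diagonal (fun i => (G.σL i)⁻¹) * X * diagonal fun i => (G.σR i)⁻¹) * G.V) = _
  calc _ = G.U * diagonal G.σL * (G.Uᵀ * G.U) * diagonal (fun i => (G.σL i)⁻¹) *
        (X * diagonal fun i => (G.σR i)⁻¹) * G.V := by simp only [Matrix.mul_assoc]
    _ = _ := by
      rw [hG.1.left_orthogonal, Matrix.mul_one, Matrix.mul_assoc G.U, hG.1.diagonal_mul_inv,
        Matrix.mul_one]

theorem StdRep.IsStandard.coord_mul_sqrtR (hG : G.IsStandard) (X : Matrix (Fin rL) (Fin rR) ℝ) :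
    G.coord X * G.sqrtR = G.U * (diagonal (fun i => (G.σL i)⁻¹) * X) * G.V := by
  change G.U * (diagonal (fun i => (G.σL i)⁻¹) * X * diagonal fun i => (G.σR i)⁻¹) * G.V *
    (G.Vᵀ * diagonal G.σR * G.V) = _
  calc _ = G.U * (diagonal (fun i => (G.σL i)⁻¹) * X) * ((diagonal fun i => (G.σR i)⁻¹) *
        (G.V * G.Vᵀ) * diagonal G.σR) * G.V := by simp only [Matrix.mul_assoc]
    _ = _ := by
      rw [hG.2.right_orthogonal, Matrix.mul_one, hG.2.diagonal_inv_mul, Matrix.mul_one]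

theorem StdRep.IsStandard.sqrtL_mul_coord_mul_sqrtR (hG : G.IsStandard)
    (X : Matrix (Fin rL) (Fin rR) ℝ) : G.sqrtL * G.coord X * G.sqrtR = G.U * X * G.V := by
  rw [Matrix.mul_assoc, hG.coord_mul_sqrtR]
  change G.U * diagonal G.σL * G.Uᵀ * (G.U * (diagonal (fun i => (G.σL i)⁻¹) * X) * G.V) = _
  calc _ = G.U * diagonal G.σL * (G.Uᵀ * G.U) * diagonal (fun i => (G.σL i)⁻¹) * X * G.V := by
        simp only [Matrix.mul_assoc]
    _ = _ := by
      rw [hG.1.left_orthogonal, Matrix.mul_one, Matrix.mul_assoc G.U, hG.1.diagonal_mul_inv,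
        Matrix.mul_one]

/-- The matrices of the form `coord X` are those which both singular projections fix. -/
theorem StdRep.IsStandard.exists_coord_eq (hG : G.IsStandard) (T : Matrix IL IR ℝ) :
    ∃ X, G.coord X = G.U * G.Uᵀ * T * (G.Vᵀ * G.V) := by
  refine ⟨diagonal G.σL * (G.Uᵀ * T * G.Vᵀ) * diagonal G.σR, ?_⟩
  change G.U * (diagonal (fun i => (G.σL i)⁻¹) * (diagonal G.σL * (G.Uᵀ * T * G.Vᵀ) *
    diagonal G.σR) * diagonal fun i => (G.σR i)⁻¹) * G.V = _
  calc _ = G.U * ((diagonal (fun i => (G.σL i)⁻¹) * diagonal G.σL) * (G.Uᵀ * T * G.Vᵀ) *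
        (diagonal G.σR * diagonal fun i => (G.σR i)⁻¹)) * G.V := by simp only [Matrix.mul_assoc]
    _ = _ := by
      rw [hG.1.diagonal_inv_mul, hG.2.diagonal_mul_inv, Matrix.one_mul, Matrix.mul_one]
      simp only [Matrix.mul_assoc]

/-- Replacing `T` by its projection to the singular spaces does not change the sampled term and does
not increase the penalties. -/
theorem StdRep.IsStandard.leastSq_projection_le (hG : G.IsStandard) (s : Finset (IL × IR))
    (c₁ c₂ c₃ : ℝ) (Bj T : Matrix IL IR ℝ) :
    leastSq (regMap s c₁ c₂ c₃ G.sqrtL G.sqrtR) (regTarget s Bj)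
        (G.U * G.Uᵀ * T * (G.Vᵀ * G.V))
      ≤ leastSq (regMap s c₁ c₂ c₃ G.sqrtL G.sqrtR) (regTarget s Bj) T := by
  have hL : G.sqrtL * (G.U * G.Uᵀ) = G.sqrtL := by
    rw [StdRep.sqrtL, Matrix.mul_assoc _ G.Uᵀ, ← Matrix.mul_assoc G.Uᵀ, hG.1.left_orthogonal,
      Matrix.one_mul]
  have hR : G.Vᵀ * G.V * G.sqrtR = G.sqrtR := by
    rw [StdRep.sqrtR, Matrix.mul_assoc G.Vᵀ (diagonal _), Matrix.mul_assoc G.Vᵀ G.V,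
      ← Matrix.mul_assoc G.V G.Vᵀ, hG.2.right_orthogonal, Matrix.one_mul]
  have e1 : G.U * G.Uᵀ * T * (G.Vᵀ * G.V) * G.sqrtR = G.U * G.Uᵀ * (T * G.sqrtR) := by
    rw [Matrix.mul_assoc, hR, Matrix.mul_assoc]
  have e2 : G.sqrtL * (G.U * G.Uᵀ * T * (G.Vᵀ * G.V)) = G.sqrtL * T * (G.Vᵀ * G.V) := by
    rw [← Matrix.mul_assoc G.sqrtL, ← Matrix.mul_assoc G.sqrtL, hL]
  have e3 : G.sqrtL * (G.U * G.Uᵀ * T * (G.Vᵀ * G.V)) * G.sqrtR = G.sqrtL * T * G.sqrtR := by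
    rw [e2, Matrix.mul_assoc, hR]
  rw [leastSq_regMap, leastSq_regMap, e3, e1, e2]
  refine add_le_add (add_le_add le_rfl (mul_le_mul_of_nonneg_left ?_ (sq_nonneg _)))
    (add_le_add (mul_le_mul_of_nonneg_left ?_ (sq_nonneg _))
      (mul_le_mul_of_nonneg_left ?_ (sq_nonneg _)))
  · exact Finset.sum_le_sum fun p _ => sum_sq_projection_mul_le hG.1.left_orthogonal _ _
  · exact Finset.sum_le_sum fun p _ => sum_sq_mul_projection_le hG.2.right_orthogonal _ _
  · refine (Finset.sum_le_sum fun a _ =>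
      sum_sq_mul_projection_le hG.2.right_orthogonal _ a).trans ?_
    rw [Finset.sum_comm, Finset.sum_comm (f := fun a b => T a b ^ 2)]
    exact Finset.sum_le_sum fun b _ => sum_sq_projection_mul_le hG.1.left_orthogonal _ _

variable [DecidableEq IL] [DecidableEq IN] [DecidableEq IR]

/-- The weight of the last penalty in the `j`-th slice. -/
def regWeight (S : Finset (IL × IN × IR)) (ζ₁₂ : ℝ) (j : IN) : ℝ :=
  √((slice S j).card / (Fintype.card IL * Fintype.card IR) * ζ₁₂)

omit [Fintype IN] in
theorem regWeight_ne_zero {S : Finset (IL × IN × IR)} {ζ₁₂ : ℝ} (hζ : 0 < ζ₁₂) {j : IN}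
    (hj : (slice S j).Nonempty) : regWeight S ζ₁₂ j ≠ 0 := by
  obtain ⟨p, -⟩ := id hj
  have h1 : 0 < Fintype.card IL := Fintype.card_pos_iff.2 ⟨p.1⟩
  have h2 : 0 < Fintype.card IR := Fintype.card_pos_iff.2 ⟨p.2⟩
  have h3 : 0 < (slice S j).card := Finset.card_pos.2 hj
  exact (Real.sqrt_pos.2 (by positivity)).ne'

/-- The linear map of the regularized least squares problem for the `j`-th slice, in the
coordinates `T`. -/
def sliceMap (S : Finset (IL × IN × IR)) (ζ₁ ζ₂ ζ₁₂ : ℝ) (j : IN) (ML : Matrix IL IL ℝ)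
    (MR : Matrix IR IR ℝ) : Matrix IL IR ℝ →ₗ[ℝ]
      ((slice S j ⊕ (slice S j × IL)) ⊕ ((IR × slice S j) ⊕ (IL × IR))) → ℝ :=
  regMap (slice S j) √((Fintype.card IL : ℝ)⁻¹ * ζ₁) √((Fintype.card IR : ℝ)⁻¹ * ζ₂)
    (regWeight S ζ₁₂ j) ML MR

/-- The right-hand side of the regularized least squares problem for the `j`-th slice. -/
def sliceTarget (B : Tensor IL IN IR) (S : Finset (IL × IN × IR)) (j : IN) :
    ((slice S j ⊕ (slice S j × IL)) ⊕ ((IR × slice S j) ⊕ (IL × IR))) → ℝ :=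
  regTarget (slice S j) (Matrix.of fun a b => B a j b)

omit [Fintype IN] in
theorem sliceMap_injective {S : Finset (IL × IN × IR)} {ζ₁ ζ₂ ζ₁₂ : ℝ} (hζ : 0 < ζ₁₂) {j : IN}
    (hj : (slice S j).Nonempty) (ML : Matrix IL IL ℝ) (MR : Matrix IR IR ℝ) {T : Matrix IL IR ℝ}
    (h : sliceMap S ζ₁ ζ₂ ζ₁₂ j ML MR T = 0) : T = 0 :=
  regMap_injective _ _ _ (regWeight_ne_zero hζ hj) ML MR h

theorem kronecker_mulVec_vec_apply {k l m n : Type*} [Fintype m] [Fintype n] (P : Matrix k m ℝ)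
    (Q : Matrix l n ℝ) (X : Matrix n m ℝ) (p : k) (i : l) :
    (Matrix.kronecker P Q *ᵥ vec X) (p, i) = (Q * X * Pᵀ) i p :=
  congrFun (kronecker_mulVec_vec Q X P) (p, i)

/-- In the coordinates `T`, the regularized target function depends on the standard representation
only through the two square roots, hence only on the tensor. -/
theorem StdRep.IsStandard.regObjective_eq (hG : G.IsStandard) (B : Tensor IL IN IR)
    (S : Finset (IL × IN × IR)) (ζ₁ ζ₂ ζ₁₂ : ℝ) (j : IN) (X : Matrix (Fin rL) (Fin rR) ℝ) :
    regObjective B S ζ₁ ζ₂ ζ₁₂ G j X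
      = leastSq (sliceMap S ζ₁ ζ₂ ζ₁₂ j G.sqrtL G.sqrtR) (sliceTarget B S j)
        (G.coord X) := by
  have h1 : ∀ b, ∑ a, (G.U * (diagonal (fun i => (G.σL i)⁻¹) * X) * G.V) a b ^ 2
      = ∑ i, (diagonal (fun i => (G.σL i)⁻¹) * X * G.V) i b ^ 2 := by
    intro b
    rw [Matrix.mul_assoc]
    exact sum_sq_orthonormal_mul hG.1.left_orthogonal _ b
  have h2 : ∀ a, ∑ b, (G.U * (X * diagonal fun i => (G.σR i)⁻¹) * G.V) a b ^ 2
      = ∑ k, (G.U * (X * diagonal fun i => (G.σR i)⁻¹)) a k ^ 2 := fun a =>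
    sum_sq_mul_orthonormal hG.2.right_orthogonal _ a
  have h3 : ∑ a, ∑ b, G.coord X a b ^ 2
      = ∑ k, ∑ i, (diagonal (fun i => (G.σL i)⁻¹) * X * diagonal fun i => (G.σR i)⁻¹) i k ^ 2 := by
    have : ∀ a, ∑ b, G.coord X a b ^ 2 = ∑ k, (G.U * (diagonal (fun i => (G.σL i)⁻¹) * X *
        diagonal fun i => (G.σR i)⁻¹)) a k ^ 2 := fun a =>
      sum_sq_mul_orthonormal hG.2.right_orthogonal _ a
    rw [Finset.sum_congr rfl fun a _ => this a, Finset.sum_comm]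
    exact Finset.sum_congr rfl fun k _ => sum_sq_orthonormal_mul hG.1.left_orthogonal _ k
  rw [sliceMap, sliceTarget, leastSq_regMap, hG.sqrtL_mul_coord_mul_sqrtR, hG.coord_mul_sqrtR,
    hG.sqrtL_mul_coord, regObjective, add_assoc]
  refine congrArg₂ (· + ·) rfl ?_
  simp only [h1, h2, h3]
  simp only [regMatrix, fromRows_mulVec, Fintype.sum_sum_type, Sum.elim_inl, Sum.elim_inr,
    smul_mulVec, Pi.smul_apply, smul_eq_mul, mul_pow, ← Finset.mul_sum,
    Fintype.sum_prod_type, kronecker_mulVec_vec_apply, transpose_transpose, diagonal_transpose]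
  refine congrArg₂ (· + ·) rfl (congrArg₂ (· + ·) ?_ rfl)
  rw [Finset.sum_comm]
  simp only [Matrix.mul_assoc]
  rfl

/-- The micro-step on one slice is a regularized least squares problem for `T` on the whole matrix
space, whose data are the two square roots. -/
theorem regMethod_exists_coord (B : Tensor IL IN IR) (S : Finset (IL × IN × IR)) (ζ₁ ζ₂ ζ₁₂ : ℝ)
    (G : (regMethod B S ζ₁ ζ₂ ζ₁₂).D rL rR) (j : IN) :
    ∃ T : Matrix IL IR ℝ,
      (∀ T', leastSq (sliceMap S ζ₁ ζ₂ ζ₁₂ j G.1.sqrtL G.1.sqrtR)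
          (sliceTarget B S j) T
        ≤ leastSq (sliceMap S ζ₁ ζ₂ ζ₁₂ j G.1.sqrtL G.1.sqrtR)
          (sliceTarget B S j) T') ∧
      (∀ a b, ((regMethod B S ζ₁ ζ₂ ζ₁₂).step G).tensor a j b
        = (G.1.sqrtL * T * G.1.sqrtR) a b) ∧
      (slice S j = ∅ → ∀ a b, ((regMethod B S ζ₁ ζ₂ ζ₁₂).step G).tensor a j b = 0) := by
  have hG : G.1.IsStandard := G.2
  let Z : Matrix (Fin rL) (Fin rR) ℝ →ₗ[ℝ] IL × IR → ℝ :=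
    { toFun := fun X p => (G.1.U * X * G.1.V) p.1 p.2
      map_add' := fun X Y => by
        funext p
        simp [Matrix.mul_add, Matrix.add_mul]
      map_smul' := fun t X => by
        funext p
        simp }
  have hobj : regObjective B S ζ₁ ζ₂ ζ₁₂ G.1 j
      = leastSq (sliceMap S ζ₁ ζ₂ ζ₁₂ j G.1.sqrtL G.1.sqrtR ∘ₗ G.1.coord)
        (sliceTarget B S j) :=
    funext fun X => hG.regObjective_eq B S ζ₁ ζ₂ ζ₁₂ j X
  have hsec : (fun X => ∑ a, ∑ b, (G.1.U * X * G.1.V) a b ^ 2) = leastSq Z 0 := by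
    funext X
    simp only [leastSq, Fintype.sum_prod_type, Pi.zero_apply, sub_zero]
    rfl
  have hsel := argMin_spec (exists_isSelectedMin
    (sliceMap S ζ₁ ζ₂ ζ₁₂ j G.1.sqrtL G.1.sqrtR ∘ₗ G.1.coord)
    (sliceTarget B S j) Z)
  rw [← hobj, ← hsec] at hsel
  set X₀ := argMin (regObjective B S ζ₁ ζ₂ ζ₁₂ G.1 j)
    (fun X => ∑ a, ∑ b, (G.1.U * X * G.1.V) a b ^ 2)
  refine ⟨G.1.coord X₀, fun T' => ?_, fun a b => ?_, fun hj a b => ?_⟩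
  · obtain ⟨X, hX⟩ := hG.exists_coord_eq T'
    have h1 := hsel.1 X
    rw [hG.regObjective_eq, hG.regObjective_eq, hX] at h1
    exact h1.trans (hG.leastSq_projection_le _ _ _ _ _ T')
  · rw [hG.sqrtL_mul_coord_mul_sqrtR]
    rfl
  · -- without samples the target function is constant, and the secondary criterion selects zero
    have hconst : ∀ X, regObjective B S ζ₁ ζ₂ ζ₁₂ G.1 j X = 0 := by
      intro X
      rw [hG.regObjective_eq, sliceMap, sliceTarget, leastSq_regMap]
      have : IsEmpty (slice S j) := by rw [hj]; infer_instance
      simp [hj, regWeight]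
    have h0 := hsel.2 0 fun z => by rw [hconst, hconst]
    simp only [Matrix.mul_zero, Matrix.zero_mul, Matrix.zero_apply, ne_eq, OfNat.ofNat_ne_zero,
      not_false_eq_true, zero_pow, Finset.sum_const_zero] at h0
    have h1 : ∑ a, ∑ b, (G.1.U * X₀ * G.1.V) a b ^ 2 = 0 :=
      le_antisymm h0 (Finset.sum_nonneg fun _ _ => Finset.sum_nonneg fun _ _ => sq_nonneg _)
    have h2 := (Finset.sum_eq_zero_iff_of_nonneg fun _ _ =>
      Finset.sum_nonneg fun _ _ => sq_nonneg _).1 h1 a (Finset.mem_univ a)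
    have h3 := (Finset.sum_eq_zero_iff_of_nonneg fun _ _ => sq_nonneg _).1 h2 b (Finset.mem_univ b)
    exact pow_eq_zero_iff two_ne_zero |>.1 h3

theorem regMethod_covers (B : Tensor IL IN IR) (S : Finset (IL × IN × IR)) (ζ₁ ζ₂ ζ₁₂ : ℝ) :
    (regMethod B S ζ₁ ζ₂ ζ₁₂).Covers := by
  intro A
  obtain ⟨G, hG, hA⟩ := exists_isStandard (A := A) ⟨rfl, rfl⟩
  exact ⟨⟨G, hG⟩, hA⟩

theorem regMethod_representationIndependent (B : Tensor IL IN IR) (S : Finset (IL × IN × IR))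
    (ζ₁ ζ₂ : ℝ) {ζ₁₂ : ℝ} (hζ : 0 < ζ₁₂) :
    (regMethod B S ζ₁ ζ₂ ζ₁₂).RepresentationIndependent := by
  intro rL rR G G' h
  have hG : G.1.IsStandard := G.2
  have hG' : G'.1.IsStandard := G'.2
  have hten : G.1.toRep.tensor = G'.1.toRep.tensor := h
  have hL : G'.1.sqrtL = G.1.sqrtL :=
    posSemidef_eq_of_mul_self_eq hG'.sqrtL_posSemidef hG.sqrtL_posSemidef
      (by rw [hG.sqrtL_mul_self, hG'.sqrtL_mul_self, hten])
  have hR : G'.1.sqrtR = G.1.sqrtR :=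
    posSemidef_eq_of_mul_self_eq hG'.sqrtR_posSemidef hG.sqrtR_posSemidef
      (by rw [hG.sqrtR_mul_self, hG'.sqrtR_mul_self, hten])
  funext a j b
  obtain ⟨T, hT, hTe, hT0⟩ := regMethod_exists_coord B S ζ₁ ζ₂ ζ₁₂ G j
  obtain ⟨T', hT', hTe', hT0'⟩ := regMethod_exists_coord B S ζ₁ ζ₂ ζ₁₂ G' j
  rcases (slice S j).eq_empty_or_nonempty with hj | hj
  · rw [hT0 hj, hT0' hj]
  · rw [hL, hR] at hT'
    have heq : T = T' := by
      rw [← sub_eq_zero]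
      refine sliceMap_injective (ζ₁ := ζ₁) (ζ₂ := ζ₂) hζ hj G.1.sqrtL G.1.sqrtR ?_
      rw [map_sub, sub_eq_zero]
      exact leastSq_minimizers_eq hT hT'
    rw [hTe, hTe', hL, hR, heq]

/-- The square roots are continuous in the tensor, also where the TT-rank changes, and the last
penalty keeps the least squares problem injective. -/
theorem regMethod_stable (B : Tensor IL IN IR) (S : Finset (IL × IN × IR))
    (ζ₁ ζ₂ : ℝ) {ζ₁₂ : ℝ} (hζ : 0 < ζ₁₂) : (regMethod B S ζ₁ ζ₂ ζ₁₂).Stable := by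
  have hcov := regMethod_covers B S ζ₁ ζ₂ ζ₁₂
  refine ⟨hcov, regMethod_representationIndependent B S ζ₁ ζ₂ hζ, ?_⟩
  have hex := fun A : Tensor IL IN IR =>
    hcov.exists_inducedMap_eq (rL := rankL A) (rR := rankR A) (A := A) ⟨rfl, rfl⟩
  choose G hGA hGf using hex
  have hG : ∀ A, (G A).1.IsStandard := fun A => (G A).2
  have hten : ∀ A, (G A).1.toRep.tensor = A := hGA
  have hLc : Continuous fun A => (G A).1.sqrtL := by
    refine continuous_of_posSemidef_mul_self (fun A => (hG A).sqrtL_posSemidef) ?_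
    simp only [(hG _).sqrtL_mul_self, hten]
    exact continuous_matL.matrix_mul continuous_matL.matrix_transpose
  have hRc : Continuous fun A => (G A).1.sqrtR := by
    refine continuous_of_posSemidef_mul_self (fun A => (hG A).sqrtR_posSemidef) ?_
    simp only [(hG _).sqrtR_mul_self, hten]
    exact continuous_matR.matrix_transpose.matrix_mul continuous_matR
  refine continuous_pi fun a => continuous_pi fun j => continuous_pi fun b => ?_
  choose T hT hTe hT0 using fun A => regMethod_exists_coord B S ζ₁ ζ₂ ζ₁₂ (G A) j
  rcases (slice S j).eq_empty_or_nonempty with hj | hj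
  · have : ∀ A, (regMethod B S ζ₁ ζ₂ ζ₁₂).inducedMap A a j b = 0 := fun A => by
      rw [hGf, hT0 A hj]
    simp only [this]
    exact continuous_const
  · have hTc : Continuous T := by
      refine continuous_iff_continuousAt.2 fun A => ?_
      rw [← continuousWithinAt_univ]
      refine continuousWithinAt_of_leastSq (Set.mem_univ A)
        (K := fun A => sliceMap S ζ₁ ζ₂ ζ₁₂ j (G A).1.sqrtL (G A).1.sqrtR)
        (fun y i => Continuous.continuousWithinAt ?_)
        (fun y hy => sliceMap_injective hζ hj _ _ hy)
        (Eventually.of_forall hT)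
      rcases i with (i | i) | (i | i)
      · exact ((hLc.matrix_mul continuous_const).matrix_mul hRc).matrix_elem _ _
      · exact continuous_const.mul ((continuous_const.matrix_mul hRc).matrix_elem _ _)
      · exact continuous_const.mul ((hLc.matrix_mul continuous_const).matrix_elem _ _)
      · exact continuous_const
    have : ∀ A, (regMethod B S ζ₁ ζ₂ ζ₁₂).inducedMap A a j b
        = ((G A).1.sqrtL * T A * (G A).1.sqrtR) a b := fun A => by rw [hGf, hTe]
    simp only [this]
    exact ((hLc.matrix_mul hTc).matrix_mul hRc).matrix_elem a b

end Regularized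

end TTStab

end

theorem theorem4p11 {IL IN IR : Type*} [Fintype IL] [Fintype IN] [Fintype IR]
    [DecidableEq IL] [DecidableEq IN] [DecidableEq IR]
    (B : TTStab.Tensor IL IN IR) (S : Finset (IL × IN × IR)) :
    (∀ A : TTStab.Tensor IL IN IR, TTStab.HasITRIP S A →
      (TTStab.alsMethod B S).FixRankStableAt A) ∧
    (∀ ζ₁ ζ₂ ζ₁₂ : ℝ, 0 ≤ ζ₁ → 0 ≤ ζ₂ → 0 < ζ₁₂ →
      (TTStab.regMethod B S ζ₁ ζ₂ ζ₁₂).Stable ∧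
        (TTStab.regMethod B S ζ₁ ζ₂ ζ₁₂).FixRankStable) := by
  refine ⟨fun A hA => TTStab.alsMethod_fixRankStableAt B S hA, fun ζ₁ ζ₂ ζ₁₂ _ _ hζ => ?_⟩
  have h := TTStab.regMethod_stable B S ζ₁ ζ₂ hζ
  exact ⟨h, h.fixRankStable⟩
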